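/- Let $H$ be a complex separable Hilbert space, $\mathcal B(H)$ the algebra of bounded linear operators on $H$ and $\mathcal K(H)$ the ideal of compact operators. Let $\mathrm{nil}_2=\{M\in\mathcal B(H): M^2=0\}$ and $\mathfrak c(\mathrm{nil}_2)=\{AB-BA: A,B\in\mathrm{nil}_2\}$; let $\mathrm{clos}$ denote closure in the operator norm, and let $\sigma(T)$ denote the spectrum of $T\in\mathcal B(H)$. For a set $\Omega\subseteq\mathbb C$ such that $\sigma(T)\cap\Omega$ is relatively clopen in $\sigma(T)$, let $E(\Omega;T)=\frac1{2\pi i}\int_\Gamma (z-T)^{-1}\,dz$ be the corresponding Riesz idempotent, where $\Gamma$ is any contour in $\mathbb C\setminus\sigma(T)$ with winding number $1$ around each point of $\sigma(T)\cap\Omega$ and winding number $0$ around each point of $\sigma(T)\setminus\Omega$; let $H(\Omega;T)$ be the range of $E(\Omega;T)$. Call $T$ semi-Fredholm if its image in the Calkin algebra $\mathcal B(H)/\mathcal K(H)$ is left or right invertible, and in that case put $\mathrm{ind}\,T=\dim\ker T-\dim\ker T^*\in\mathbb Z\cup\{\pm\infty\}$. An operator $T\in\mathcal B(H)$ is weakly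 balanced if (i) $\sigma(T)=\sigma(-T)$, and (ii) $\dim H(\Omega_1;T)=\dim H(-\Omega_1;T)$ whenever $\Omega_1,\Omega_2\subseteq\mathbb C$ are disjoint open sets with $\sigma(T)\subseteq\Omega_1\cup\Omega_2$. It is balanced if, in addition, (iii) for every $\alpha\in\mathbb C$, $T-\alpha I$ is semi-Fredholm if and only if $T+\alpha I$ is, in which case $\mathrm{ind}(T-\alpha I)=\mathrm{ind}(T+\alpha I)$. Let $\mathrm{Bal}(H)$ and $\mathrm{WBal}(H)$ be the sets of balanced and of weakly balanced operators. Theorem. For a compact operator $K\in\mathcal K(H)$ the following are equivalent: (a) $K\in\mathrm{clos}(\mathfrak c(\mathrm{nil}_2))$; (b) $K\in\mathrm{clos}(\mathrm{Bal}(H))$; (c) $K\in\mathrm{Bal}(H)$; (d) $K\in\mathrm{WBal}(H)$; (e) $K\in\mathrm{clos}(\mathcal K(H)\cap\mathfrak c(\mathrm{nil}_2))$. -/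

import Mathlib

open scoped Pointwise ENNReal

noncomputable section

section Contours

/-- A closed curve of class `C¹` in the complex plane, parametrised by `[0, 2π]`. Only the
restriction of `toFun` to `[0, 2π]` matters; the derivative is allowed to vanish, so every closed
polygon has such a parametrisation. -/
structure ClosedCurve where
  toFun : ℝ → ℂ
  contDiff : ContDiff ℝ 1 toFun
  closed : toFun 0 = toFun (2 * Real.pi)

/-- The trace of a closed curve. -/
def ClosedCurve.trace (γ : ClosedCurve) : Set ℂ := γ.toFun '' Set.Icc 0 (2 * Real.pi)

/-- The integral `∫_γ f(z) dz`. -/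
def ClosedCurve.integral {E : Type*} [NormedAddCommGroup E] [NormedSpace ℂ E]
    (γ : ClosedCurve) (f : ℂ → E) : E :=
  ∫ t in (0 : ℝ)..(2 * Real.pi), deriv γ.toFun t • f (γ.toFun t)

/-- A contour (cycle): a finite formal sum of closed curves. -/
abbrev Contour := List ClosedCurve

/-- The trace of a contour. -/
def Contour.trace (Γ : Contour) : Set ℂ := ⋃ γ ∈ Γ, γ.trace

/-- The integral `∫_Γ f(z) dz`. -/
def Contour.integral {E : Type*} [NormedAddCommGroup E] [NormedSpace ℂ E]
    (Γ : Contour) (f : ℂ → E) : E :=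
  (Γ.map fun γ => γ.integral f).sum

/-- The winding number `(1 / 2πi) ∫_Γ dz / (z - w)` of a contour `Γ` around `w ∉ Γ`. -/
def Contour.windingNumber (Γ : Contour) (w : ℂ) : ℂ :=
  (2 * Real.pi * Complex.I)⁻¹ * Γ.integral fun z => (z - w)⁻¹

end Contours

section Operators

variable {H : Type*} [NormedAddCommGroup H] [InnerProductSpace ℂ H] [CompleteSpace H]

/-- `Γ` lies in the resolvent set of `T`, winds once around every point of `σ(T) ∩ Ω`, and does
not wind around any point of `σ(T) \ Ω`. -/
def Contour.Separates (Γ : Contour) (T : H →L[ℂ] H) (Ω : Set ℂ) : Prop :=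
  Disjoint Γ.trace (spectrum ℂ T) ∧
    (∀ w ∈ spectrum ℂ T ∩ Ω, Γ.windingNumber w = 1) ∧
    (∀ w ∈ spectrum ℂ T \ Ω, Γ.windingNumber w = 0)

/-- `E` is the Riesz idempotent `E(Ω; T) = (1 / 2πi) ∫_Γ (z - T)⁻¹ dz` for the part of the
spectrum of `T` in `Ω`. If `σ(T) ∩ Ω` is relatively clopen in `σ(T)`, a separating contour exists
and, by Cauchy's theorem, the integral does not depend on it. -/
def IsRieszIdempotent (T : H →L[ℂ] H) (Ω : Set ℂ) (E : H →L[ℂ] H) : Prop :=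
  ∃ Γ : Contour, Γ.Separates T Ω ∧
    E = (2 * Real.pi * Complex.I : ℂ)⁻¹ • Γ.integral (resolvent T)

/-- The dimension of a linear subspace, in `{0, 1, 2, …} ∪ {∞}`. -/
def hilbertDim (M : Submodule ℂ H) : ℕ∞ := Cardinal.toENat (Module.rank ℂ M)

/-- The nullity `nul T = dim ker T`. -/
def nullity (T : H →L[ℂ] H) : ℕ∞ := hilbertDim (LinearMap.ker (T : H →ₗ[ℂ] H))

variable (H) in
/-- The two-sided ideal `𝒦(H)` of compact operators in `ℬ(H)`. -/
def compactIdeal : TwoSidedIdeal (H →L[ℂ] H) :=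
  TwoSidedIdeal.mk' {K : H →L[ℂ] H | IsCompactOperator K}
    isCompactOperator_zero
    (fun hx hy => IsCompactOperator.add hx hy)
    (fun hx => IsCompactOperator.neg hx)
    (fun {x _} hy => IsCompactOperator.clm_comp hy x)
    (fun {_ y} hx => IsCompactOperator.comp_clm hx y)

variable (H) in
/-- The Calkin algebra `ℬ(H) / 𝒦(H)`. -/
abbrev CalkinAlgebra := (compactIdeal H).ringCon.Quotient

variable (H) in
/-- The quotient map `π` of `ℬ(H)` onto the Calkin algebra. -/
def calkinMap : (H →L[ℂ] H) →+* CalkinAlgebra H := (compactIdeal H).ringCon.mk'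

/-- `T` is semi-Fredholm: `π(T)` is left invertible or right invertible in the Calkin algebra. -/
def IsSemiFredholm (T : H →L[ℂ] H) : Prop :=
  (∃ s : CalkinAlgebra H, s * calkinMap H T = 1) ∨ (∃ s : CalkinAlgebra H, calkinMap H T * s = 1)

/-- The index `nul T - nul T*`, in `ℤ ∪ {-∞, ∞}`. It is used for semi-Fredholm `T` only, where
at least one of the two nullities is finite. -/
def fredholmIndex (T : H →L[ℂ] H) : EReal :=
  (((nullity T : ℕ∞) : ℝ≥0∞) : EReal) -
    (((nullity (ContinuousLinearMap.adjoint T) : ℕ∞) : ℝ≥0∞) : EReal)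

/-- `T` is weakly balanced: `σ(T) = σ(-T)`, and whenever two disjoint open sets `Ω₁`, `Ω₂` cover
`σ(T)`, the ranges of the Riesz idempotents `E(Ω₁; T)` and `E(-Ω₁; T)` have the same dimension. -/
structure IsWeaklyBalanced (T : H →L[ℂ] H) : Prop where
  spectrum_eq : spectrum ℂ T = spectrum ℂ (-T)
  dim_eq : ∀ Ω₁ Ω₂ : Set ℂ, IsOpen Ω₁ → IsOpen Ω₂ → Disjoint Ω₁ Ω₂ →
    spectrum ℂ T ⊆ Ω₁ ∪ Ω₂ →
    ∀ E F : H →L[ℂ] H, IsRieszIdempotent T Ω₁ E → IsRieszIdempotent T (-Ω₁) F →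
      hilbertDim (LinearMap.range (E : H →ₗ[ℂ] H)) = hilbertDim (LinearMap.range (F : H →ₗ[ℂ] H))

/-- `T` is balanced: it is weakly balanced, and the semi-Fredholm domain and the index of
`T - α` are symmetric under `α ↦ -α`. -/
structure IsBalanced (T : H →L[ℂ] H) : Prop extends IsWeaklyBalanced T where
  semiFredholm_iff : ∀ α : ℂ, IsSemiFredholm (T - α • (1 : H →L[ℂ] H)) ↔
    IsSemiFredholm (T + α • (1 : H →L[ℂ] H))
  index_eq : ∀ α : ℂ, IsSemiFredholm (T - α • (1 : H →L[ℂ] H)) →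
    fredholmIndex (T - α • (1 : H →L[ℂ] H)) = fredholmIndex (T + α • (1 : H →L[ℂ] H))

variable (H) in
/-- The set `WBal(H)` of weakly balanced operators. -/
def WBal : Set (H →L[ℂ] H) := {T | IsWeaklyBalanced T}

variable (H) in
/-- The set `Bal(H)` of balanced operators. -/
def Bal : Set (H →L[ℂ] H) := {T | IsBalanced T}

variable (H) in
/-- The set `nil₂` of square-zero operators. -/
def nilTwo : Set (H →L[ℂ] H) := {M | M ^ 2 = 0}

/-- The set `𝔠(Ω)` of commutators `[A, B] = AB - BA` with `A, B ∈ Ω`. -/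
def commutatorsOf (Ω : Set (H →L[ℂ] H)) : Set (H →L[ℂ] H) :=
  {T | ∃ A ∈ Ω, ∃ B ∈ Ω, T = A * B - B * A}

end Operators

end

/-! Everything passes through one condition on the compact operator `K`, `HasSymmetricRoots`: the
algebraic multiplicities of `μ` and `-μ` agree.

Necessity. For an eigenvalue `c ≠ 0` the multiplicity is the rank of the Riesz idempotent over a
small circle about `c`, and this rank is locally constant in the operator
(`eventually_rank_riesz_circle_eq`). Hence it suffices to compare the ranks over circles about `c`
and `-c` for operators near `K` (`hasSymmetricRoots_of_mem_closure`). For weakly balanced operators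
they agree by definition. If `T = AB - BA` with `A² = B² = 0`, then `A` and `B` anticommute with
`T`, so both map the range of the idempotent `E` at `c` into the range of the idempotent `F` at
`-c`. As `T` is injective on `ran E` and `T x = A (B x) + B (-A x)` with `A x ∈ ker A`, rank-nullity
for `A` on `ran F` gives `dim ran E ≤ dim ran F` (`finrank_riesz_le_of_commutator`).

Balance. A Riesz idempotent of `K` has as range the sum of the enclosed root spaces, or an
infinite-dimensional range if `H` is infinite-dimensional and `0` is enclosed. Symmetric
multiplicities thus give weak balance; the index conditions hold because `K - α` is Fredholm of
index `0` for `α ≠ 0`.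

Sufficiency. Compress `K` to a large finite-dimensional subspace and triangulate there. The diagonal
entries cluster at eigenvalues of `K`, with the right multiplicities, or are small. Moving them to
the cluster centres and then slightly apart makes them distinct and symmetric under negation at
small cost in norm (`exists_commutator_near_upperTriangular`). The resulting matrix is
diagonalisable, and swapping the eigenvectors of `e` and `-e` writes it as a commutator of
square-zero matrices. -/

open MeasureTheory Set Metric Filter Topology

noncomputable section

/-! ### Calculus of integrals over closed curves and contours -/

section ContourIntegrals

variable {E F : Type*} [NormedAddCommGroup E] [NormedSpace ℂ E]
  [NormedAddCommGroup F] [NormedSpace ℂ F]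

/-- The circle of centre `c` and radius `r`, as a closed curve. -/
def ClosedCurve.circle (c : ℂ) (r : ℝ) : ClosedCurve where
  toFun := circleMap c r
  contDiff := contDiff_circleMap c r
  closed := by simp [circleMap]

/-- The circle of centre `c` and radius `r`, as a contour. -/
abbrev Contour.circle (c : ℂ) (r : ℝ) : Contour := [ClosedCurve.circle c r]

namespace ClosedCurve

theorem isCompact_trace (γ : ClosedCurve) : IsCompact γ.trace :=
  isCompact_Icc.image γ.contDiff.continuous

theorem mem_trace (γ : ClosedCurve) {t : ℝ} (ht : t ∈ Icc 0 (2 * Real.pi)) :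
    γ.toFun t ∈ γ.trace := mem_image_of_mem _ ht

theorem continuous_deriv (γ : ClosedCurve) : Continuous (deriv γ.toFun) :=
  γ.contDiff.continuous_deriv le_rfl

theorem continuousOn_integrand (γ : ClosedCurve) {f : ℂ → E} (hf : ContinuousOn f γ.trace) :
    ContinuousOn (fun t => deriv γ.toFun t • f (γ.toFun t)) (Icc 0 (2 * Real.pi)) :=
  γ.continuous_deriv.continuousOn.smul
    (hf.comp γ.contDiff.continuous.continuousOn fun _ ht => γ.mem_trace ht)

theorem intervalIntegrable (γ : ClosedCurve) {f : ℂ → E} (hf : ContinuousOn f γ.trace) :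
    IntervalIntegrable (fun t => deriv γ.toFun t • f (γ.toFun t)) volume 0 (2 * Real.pi) := by
  apply ContinuousOn.intervalIntegrable
  rw [uIcc_of_le Real.two_pi_pos.le]
  exact γ.continuousOn_integrand hf

theorem integral_congr (γ : ClosedCurve) {f g : ℂ → E} (h : EqOn f g γ.trace) :
    γ.integral f = γ.integral g := by
  apply intervalIntegral.integral_congr
  intro t ht
  rw [uIcc_of_le Real.two_pi_pos.le] at ht
  simp only [h (γ.mem_trace ht)]

theorem integral_add (γ : ClosedCurve) {f g : ℂ → E} (hf : ContinuousOn f γ.trace)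
    (hg : ContinuousOn g γ.trace) :
    γ.integral (fun z => f z + g z) = γ.integral f + γ.integral g := by
  simp only [integral, smul_add]
  exact intervalIntegral.integral_add (γ.intervalIntegrable hf) (γ.intervalIntegrable hg)

theorem integral_clm [CompleteSpace E] [CompleteSpace F] (γ : ClosedCurve) {f : ℂ → E}
    (hf : ContinuousOn f γ.trace) (L : E →L[ℂ] F) :
    γ.integral (fun z => L (f z)) = L (γ.integral f) := by
  simp only [integral]
  rw [← ContinuousLinearMap.intervalIntegral_comp_comm L (γ.intervalIntegrable hf)]
  simp

theorem integral_eq_zero_of_hasDerivAt [CompleteSpace E] (γ : ClosedCurve) {f g : ℂ → E}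
    (hg : ContinuousOn g γ.trace) (h : ∀ z ∈ γ.trace, HasDerivAt f (g z) z) :
    γ.integral g = 0 := by
  have key := intervalIntegral.integral_eq_sub_of_hasDerivAt (a := 0) (b := 2 * Real.pi)
    (f := fun t => f (γ.toFun t)) (f' := fun t => deriv γ.toFun t • g (γ.toFun t))
    (fun t ht => by
      rw [uIcc_of_le Real.two_pi_pos.le] at ht
      have h1 : HasDerivAt γ.toFun (deriv γ.toFun t) t :=
        ((γ.contDiff.differentiable (by simp)) t).hasDerivAt
      exact (h _ (γ.mem_trace ht)).scomp t h1)
    (γ.intervalIntegrable hg)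
  rw [integral, key, γ.closed, sub_self]

theorem integral_integral_swap [CompleteSpace E] (γ η : ClosedCurve) {f : ℂ → ℂ → E}
    (hf : ContinuousOn (Function.uncurry f) (γ.trace ×ˢ η.trace)) :
    γ.integral (fun z => η.integral (f z)) = η.integral (fun w => γ.integral fun z => f z w) := by
  simp only [integral, ← intervalIntegral.integral_smul]
  have hpi := Real.two_pi_pos.le
  simp only [intervalIntegral.integral_of_le hpi]
  have hint : Integrable (Function.uncurry fun s t : ℝ =>
      deriv γ.toFun s • deriv η.toFun t • f (γ.toFun s) (η.toFun t))
      ((volume.restrict (Ioc 0 (2 * Real.pi))).prod (volume.restrict (Ioc 0 (2 * Real.pi)))) := by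
    rw [Measure.prod_restrict]
    have hc : ContinuousOn (Function.uncurry fun s t : ℝ =>
        deriv γ.toFun s • deriv η.toFun t • f (γ.toFun s) (η.toFun t))
        (Icc 0 (2 * Real.pi) ×ˢ Icc 0 (2 * Real.pi)) := by
      apply ((γ.continuous_deriv.comp continuous_fst).continuousOn).smul
      apply ((η.continuous_deriv.comp continuous_snd).continuousOn).smul
      refine hf.comp (f := fun p : ℝ × ℝ => (γ.toFun p.1, η.toFun p.2)) ?_ ?_
      · exact ((γ.contDiff.continuous.comp continuous_fst).prodMk
          (η.contDiff.continuous.comp continuous_snd)).continuousOn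
      · exact fun p hp => ⟨γ.mem_trace hp.1, η.mem_trace hp.2⟩
    exact (hc.integrableOn_compact (isCompact_Icc.prod isCompact_Icc)).mono_set
      (prod_mono Ioc_subset_Icc_self Ioc_subset_Icc_self)
  rw [MeasureTheory.integral_integral_swap hint]
  refine setIntegral_congr_fun measurableSet_Ioc fun t _ => ?_
  refine setIntegral_congr_fun measurableSet_Ioc fun s _ => ?_
  exact smul_comm _ _ _

theorem circle_integral (c : ℂ) (r : ℝ) (f : ℂ → E) :
    (circle c r).integral f = ∮ z in C(c, r), f z := rfl

theorem trace_circle (c : ℂ) {r : ℝ} (hr : 0 ≤ r) : (circle c r).trace = Metric.sphere c r := by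
  refine subset_antisymm ?_ ?_
  · rintro _ ⟨t, -, rfl⟩
    exact circleMap_mem_sphere c hr t
  · rw [← abs_of_nonneg hr, ← image_circleMap_Ioc, abs_of_nonneg hr]
    exact image_mono Ioc_subset_Icc_self

end ClosedCurve

namespace Contour

theorem trace_nil : Contour.trace [] = ∅ := by simp [Contour.trace]

theorem trace_cons (γ : ClosedCurve) (Γ : Contour) :
    Contour.trace (γ :: Γ) = γ.trace ∪ Contour.trace Γ := by
  simp [Contour.trace, iUnion_or, iUnion_union_distrib]

theorem integral_nil (f : ℂ → E) : Contour.integral [] f = 0 := by simp [Contour.integral]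

theorem integral_cons (γ : ClosedCurve) (Γ : Contour) (f : ℂ → E) :
    Contour.integral (γ :: Γ) f = γ.integral f + Contour.integral Γ f := by
  simp [Contour.integral]

theorem trace_circle (c : ℂ) {r : ℝ} (hr : 0 ≤ r) :
    (circle c r).trace = Metric.sphere c r := by
  rw [trace_cons, trace_nil, union_empty, ClosedCurve.trace_circle c hr]

theorem circle_integral (c : ℂ) (r : ℝ) (f : ℂ → E) :
    (circle c r).integral f = ∮ z in C(c, r), f z := by
  rw [integral_cons, integral_nil, add_zero, ClosedCurve.circle_integral]

theorem isCompact_trace (Γ : Contour) : IsCompact Γ.trace := by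
  induction Γ with
  | nil => simp [trace_nil]
  | cons γ Γ ih => rw [trace_cons]; exact γ.isCompact_trace.union ih

theorem integral_congr (Γ : Contour) {f g : ℂ → E} (h : EqOn f g Γ.trace) :
    Γ.integral f = Γ.integral g := by
  induction Γ with
  | nil => simp [integral_nil]
  | cons γ Γ ih =>
    rw [trace_cons, eqOn_union] at h
    rw [integral_cons, integral_cons, γ.integral_congr h.1, ih h.2]

theorem integral_add (Γ : Contour) {f g : ℂ → E} (hf : ContinuousOn f Γ.trace)
    (hg : ContinuousOn g Γ.trace) :
    Γ.integral (fun z => f z + g z) = Γ.integral f + Γ.integral g := by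
  induction Γ with
  | nil => simp [integral_nil]
  | cons γ Γ ih =>
    rw [trace_cons] at hf hg
    rw [integral_cons, integral_cons, integral_cons,
      γ.integral_add (hf.mono subset_union_left) (hg.mono subset_union_left),
      ih (hf.mono subset_union_right) (hg.mono subset_union_right)]
    abel

theorem integral_clm [CompleteSpace E] [CompleteSpace F] (Γ : Contour) {f : ℂ → E}
    (hf : ContinuousOn f Γ.trace) (L : E →L[ℂ] F) :
    Γ.integral (fun z => L (f z)) = L (Γ.integral f) := by
  induction Γ with
  | nil => simp [integral_nil]
  | cons γ Γ ih =>
    rw [trace_cons] at hf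
    rw [integral_cons, integral_cons, γ.integral_clm (hf.mono subset_union_left),
      ih (hf.mono subset_union_right), map_add]

theorem integral_smul_const [CompleteSpace E] (Γ : Contour) {f : ℂ → ℂ}
    (hf : ContinuousOn f Γ.trace) (x : E) :
    Γ.integral (fun z => f z • x) = Γ.integral f • x := by
  simpa using Γ.integral_clm hf (ContinuousLinearMap.smulRight (1 : ℂ →L[ℂ] ℂ) x)

theorem integral_eq_zero_of_hasDerivAt [CompleteSpace E] (Γ : Contour) {f g : ℂ → E}
    (hg : ContinuousOn g Γ.trace) (h : ∀ z ∈ Γ.trace, HasDerivAt f (g z) z) :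
    Γ.integral g = 0 := by
  induction Γ with
  | nil => simp [integral_nil]
  | cons γ Γ ih =>
    rw [trace_cons] at hg h
    rw [integral_cons, γ.integral_eq_zero_of_hasDerivAt (hg.mono subset_union_left)
      fun z hz => h z (Or.inl hz), ih (hg.mono subset_union_right) fun z hz => h z (Or.inr hz),
      add_zero]

end Contour

end ContourIntegrals

/-! ### Winding numbers and Cauchy kernels -/

section WindingNumbers

/-- Cauchy kernels with poles in a closed disc avoided by the curve have the same integral. -/
theorem ClosedCurve.integral_sub_inv_eq (γ : ClosedCurve) {c w : ℂ} {r : ℝ}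
    (hγ : Disjoint γ.trace (closedBall c r)) (hw : w ∈ closedBall c r) :
    γ.integral (fun z => (z - w)⁻¹) = γ.integral (fun z => (z - c)⁻¹) := by
  have hr : 0 ≤ r := dist_nonneg.trans hw
  have hout : ∀ z ∈ γ.trace, r < ‖z - c‖ := fun z hz => by
    simpa [dist_eq_norm] using disjoint_left.1 hγ hz
  have hc0 : ∀ z ∈ γ.trace, z - c ≠ 0 := fun z hz => norm_pos_iff.1 (hr.trans_lt (hout z hz))
  have hwc : ‖w - c‖ ≤ r := by simpa [dist_eq_norm] using hw
  have hw0 : ∀ z ∈ γ.trace, z - w ≠ 0 := fun z hz h => by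
    have := hout z hz
    rw [sub_eq_zero.1 h] at this
    linarith
  have hcc : ContinuousOn (fun z : ℂ => (z - c)⁻¹) γ.trace :=
    (continuousOn_id.sub continuousOn_const).inv₀ hc0
  have hcw : ContinuousOn (fun z : ℂ => (z - w)⁻¹) γ.trace :=
    (continuousOn_id.sub continuousOn_const).inv₀ hw0
  have key : γ.integral (fun z => (z - w)⁻¹ + -(z - c)⁻¹) = 0 := by
    -- For `z` outside the disc, `(z - w) / (z - c)` is at distance less than `1` from `1`, so the
    -- principal logarithm provides a primitive of the difference of the two kernels.
    refine γ.integral_eq_zero_of_hasDerivAt (f := fun z => Complex.log ((z - w) / (z - c)))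
      (hcw.add hcc.neg) fun z hz => ?_
    have hz0 := hc0 z hz
    have hzw := hw0 z hz
    have hslit : (z - w) / (z - c) ∈ Complex.slitPlane := by
      have h1 : (z - w) / (z - c) = 1 + (c - w) / (z - c) := by field_simp; ring
      rw [h1]
      apply Complex.mem_slitPlane_of_norm_lt_one
      rw [norm_div, div_lt_one (norm_pos_iff.2 hz0), norm_sub_rev]
      exact hwc.trans_lt (hout z hz)
    have hd : HasDerivAt (fun z => (z - w) / (z - c))
        ((1 * (z - c) - (z - w) * 1) / (z - c) ^ 2) z :=
      ((hasDerivAt_id z).sub_const w).div ((hasDerivAt_id z).sub_const c) hz0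
    refine (hd.clog hslit).congr_deriv ?_
    field_simp
    ring
  rw [γ.integral_add (f := fun z => (z - w)⁻¹) (g := fun z => -(z - c)⁻¹) hcw hcc.neg] at key
  have hneg : γ.integral (fun z => -(z - c)⁻¹) = -γ.integral (fun z => (z - c)⁻¹) := by
    simpa using γ.integral_clm hcc (-ContinuousLinearMap.id ℂ ℂ)
  rw [hneg] at key
  linear_combination key

theorem Contour.windingNumber_circle_of_mem {c w : ℂ} {r : ℝ} (hw : w ∈ ball c r) :
    (Contour.circle c r).windingNumber w = 1 := by
  rw [Contour.windingNumber, Contour.circle_integral, circleIntegral.integral_sub_inv_of_mem_ball hw]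
  exact inv_mul_cancel₀ Complex.two_pi_I_ne_zero

theorem circleIntegral_sub_inv_of_notMem {c w : ℂ} {r : ℝ} (hr : 0 ≤ r)
    (hw : w ∉ closedBall c r) : (∮ z in C(c, r), (z - w)⁻¹) = 0 := by
  have h0 : ∀ z ∈ closedBall c r, z - w ≠ 0 := fun z hz h => hw (sub_eq_zero.1 h ▸ hz)
  refine Complex.circleIntegral_eq_zero_of_differentiable_on_off_countable hr countable_empty
    ((continuousOn_id.sub continuousOn_const).inv₀ h0) fun z hz => ?_
  exact (differentiableAt_id.sub_const w).inv (h0 z (ball_subset_closedBall hz.1))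

theorem Contour.windingNumber_circle_of_notMem {c w : ℂ} {r : ℝ} (hr : 0 ≤ r)
    (hw : w ∉ closedBall c r) : (Contour.circle c r).windingNumber w = 0 := by
  rw [Contour.windingNumber, Contour.circle_integral, circleIntegral_sub_inv_of_notMem hr hw,
    mul_zero]

end WindingNumbers

/-! ### Riesz integrals in a Banach algebra -/

section BanachAlgebra

variable {A : Type*} [NormedRing A] [NormedAlgebra ℂ A] [CompleteSpace A]

/-- The Riesz integral `(1 / 2πi) ∫_Γ (z - a)⁻¹ dz`. -/
def Contour.riesz (Γ : Contour) (a : A) : A :=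
  (2 * Real.pi * Complex.I : ℂ)⁻¹ • Γ.integral (resolvent a)

theorem continuousOn_resolvent (a : A) {S : Set ℂ} (hS : Disjoint S (spectrum ℂ a)) :
    ContinuousOn (resolvent a) S := fun z hz =>
  (spectrum.hasDerivAt_resolvent_const_left (a := a)
    (by simpa [spectrum] using disjoint_left.1 hS hz)).continuousAt.continuousWithinAt

omit [CompleteSpace A] in
theorem isUnit_of_notMem_spectrum {a : A} {z : ℂ} (hz : z ∉ spectrum ℂ a) :
    IsUnit (algebraMap ℂ A z - a) := by
  simpa [spectrum.mem_iff] using hz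

omit [CompleteSpace A] in
theorem resolvent_mul_resolvent {a : A} {z w : ℂ} (hz : z ∉ spectrum ℂ a)
    (hw : w ∉ spectrum ℂ a) (hzw : z ≠ w) :
    resolvent a z * resolvent a w = (z - w)⁻¹ • resolvent a w - (z - w)⁻¹ • resolvent a z := by
  have h1 := Ring.inverse_mul_cancel _ (isUnit_of_notMem_spectrum hz)
  have h2 := Ring.mul_inverse_cancel _ (isUnit_of_notMem_spectrum hw)
  have h3 : resolvent a w - resolvent a z = (z - w) • (resolvent a z * resolvent a w) := by
    calc resolvent a w - resolvent a z
        = resolvent a z * (algebraMap ℂ A z - a) * resolvent a w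
          - resolvent a z * ((algebraMap ℂ A w - a) * resolvent a w) := by
            simp only [resolvent] at *
            rw [h1, h2, one_mul, mul_one]
      _ = resolvent a z * (algebraMap ℂ A (z - w)) * resolvent a w := by
            rw [map_sub]; noncomm_ring
      _ = (z - w) • (resolvent a z * resolvent a w) := by
            rw [← Algebra.commutes, mul_assoc, Algebra.smul_def]
  rw [← smul_sub, h3, smul_smul, inv_mul_cancel₀ (sub_ne_zero.2 hzw), one_smul]

/-- Expand the product as a double integral and apply the resolvent identity. The term with
`resolvent a z` integrates to zero over the circle, since `z` lies outside the disc. In the other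
term, after swapping the integrals, the Cauchy kernel integrates over `γ` to a value independent of
`w` in the disc. -/
theorem ClosedCurve.integral_resolvent_mul_circle (γ : ClosedCurve) {a : A} {c : ℂ} {r : ℝ}
    (hr : 0 ≤ r) (hγa : Disjoint γ.trace (spectrum ℂ a))
    (hγ : Disjoint γ.trace (closedBall c r)) (hc : Disjoint (sphere c r) (spectrum ℂ a)) :
    γ.integral (resolvent a) * (circle c r).integral (resolvent a) =
      γ.integral (fun z => (z - c)⁻¹) • (circle c r).integral (resolvent a) := by
  set η := circle c r with hη
  have hηt : η.trace = sphere c r := trace_circle c hr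
  have hRγ := continuousOn_resolvent a hγa
  have hRη : ContinuousOn (resolvent a) η.trace := hηt ▸ continuousOn_resolvent a hc
  have hne : ∀ z ∈ γ.trace, ∀ w ∈ η.trace, z - w ≠ 0 := fun z hz w hw h => by
    rw [hηt] at hw
    exact disjoint_left.1 hγ hz (sub_eq_zero.1 h ▸ sphere_subset_closedBall hw)
  have h1 : γ.integral (resolvent a) * η.integral (resolvent a) =
      γ.integral (fun z => η.integral fun w => (z - w)⁻¹ • resolvent a w) := by
    rw [← ContinuousLinearMap.mul_apply' ℂ A, ← ContinuousLinearMap.flip_apply,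
      ← γ.integral_clm hRγ]
    refine γ.integral_congr fun z hz => ?_
    have hkc : ContinuousOn (fun w : ℂ => (z - w)⁻¹) η.trace :=
      (continuousOn_const.sub continuousOn_id).inv₀ (hne z hz)
    simp only [ContinuousLinearMap.flip_apply]
    rw [← η.integral_clm hRη]
    have hE : EqOn (fun w => (ContinuousLinearMap.mul ℂ A (resolvent a z)) (resolvent a w))
        (fun w => (z - w)⁻¹ • resolvent a w + (-(z - w)⁻¹) • resolvent a z) η.trace := by
      intro w hw
      simp only [ContinuousLinearMap.mul_apply']
      rw [resolvent_mul_resolvent (disjoint_left.1 hγa hz)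
        (disjoint_left.1 hc (hηt ▸ hw)) (sub_ne_zero.1 (hne z hz w hw)), neg_smul, sub_eq_add_neg]
    rw [η.integral_congr hE, η.integral_add (f := fun w => (z - w)⁻¹ • resolvent a w)
      (g := fun w => (-(z - w)⁻¹) • resolvent a z) (hkc.smul hRη) (hkc.neg.smul continuousOn_const)]
    have h0 : η.integral (fun w => (-(z - w)⁻¹) • resolvent a z) = 0 := by
      have h2 : EqOn (fun w => (-(z - w)⁻¹) • resolvent a z)
          (fun w => ContinuousLinearMap.smulRight (1 : ℂ →L[ℂ] ℂ) (resolvent a z) ((w - z)⁻¹))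
          η.trace := fun w _ => by
        simp [← inv_neg]
      rw [η.integral_congr h2, η.integral_clm]
      · rw [hη, circle_integral, circleIntegral_sub_inv_of_notMem hr (disjoint_left.1 hγ hz)]
        simp
      · exact (continuousOn_id.sub continuousOn_const).inv₀ fun w hw => by
          rw [← neg_sub]; exact neg_ne_zero.2 (hne z hz w hw)
    rw [h0, add_zero]
  rw [h1, γ.integral_integral_swap η]
  · have h2 : EqOn (fun w => γ.integral fun z => (z - w)⁻¹ • resolvent a w)
        (fun w => (γ.integral (fun z => (z - c)⁻¹) • ContinuousLinearMap.id ℂ A) (resolvent a w))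
        η.trace := by
      intro w hw
      have hkc : ContinuousOn (fun z : ℂ => (z - w)⁻¹) γ.trace :=
        (continuousOn_id.sub continuousOn_const).inv₀ fun z hz => hne z hz w hw
      have := γ.integral_clm hkc (ContinuousLinearMap.smulRight (1 : ℂ →L[ℂ] ℂ) (resolvent a w))
      simp only [ContinuousLinearMap.smulRight_apply, one_apply_eq_self] at this
      simp only [smul_apply, ContinuousLinearMap.id_apply]
      rw [this, γ.integral_sub_inv_eq hγ (sphere_subset_closedBall (hηt ▸ hw))]
    rw [η.integral_congr h2, η.integral_clm hRη]
    simp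
  · refine ContinuousOn.smul ?_ ?_
    · exact (continuousOn_fst.sub continuousOn_snd).inv₀ fun p hp => hne _ hp.1 _ hp.2
    · exact hRη.comp continuousOn_snd fun p hp => hp.2

theorem Contour.integral_resolvent_mul_circle (Γ : Contour) {a : A} {c : ℂ} {r : ℝ}
    (hr : 0 ≤ r) (hΓa : Disjoint Γ.trace (spectrum ℂ a))
    (hΓ : Disjoint Γ.trace (closedBall c r)) (hc : Disjoint (sphere c r) (spectrum ℂ a)) :
    Γ.integral (resolvent a) * (circle c r).integral (resolvent a) =
      Γ.integral (fun z => (z - c)⁻¹) • (circle c r).integral (resolvent a) := by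
  induction Γ with
  | nil => simp [integral_nil]
  | cons γ Γ ih =>
    rw [trace_cons, disjoint_union_left] at hΓa hΓ
    rw [integral_cons γ Γ, integral_cons γ Γ, add_mul, add_smul, ih hΓa.2 hΓ.2]
    congr 1
    simpa [circle, integral_cons, integral_nil] using
      γ.integral_resolvent_mul_circle hr hΓa.1 hΓ.1 hc

/-- Comparing an arbitrary contour with circles only is enough: this yields idempotency over circles
and shows how a general Riesz integral acts on the spectral part near `0`, without a homology form
of Cauchy's theorem. -/
theorem Contour.riesz_mul_riesz_circle (Γ : Contour) {a : A} {c : ℂ} {r : ℝ}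
    (hr : 0 ≤ r) (hΓa : Disjoint Γ.trace (spectrum ℂ a))
    (hΓ : Disjoint Γ.trace (closedBall c r)) (hc : Disjoint (sphere c r) (spectrum ℂ a)) :
    Γ.riesz a * (circle c r).riesz a = Γ.windingNumber c • (circle c r).riesz a := by
  rw [riesz, riesz, smul_mul_assoc, mul_smul_comm, Γ.integral_resolvent_mul_circle hr hΓa hΓ hc,
    windingNumber]
  simp only [smul_smul]
  congr 1
  ring

theorem Contour.riesz_circle_eq_of_annulus {a : A} {c : ℂ} {r R : ℝ} (hr : 0 < r) (hrR : r ≤ R)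
    (h : Disjoint (closedBall c R \ ball c r) (spectrum ℂ a)) :
    (circle c R).riesz a = (circle c r).riesz a := by
  rw [riesz, riesz, circle_integral, circle_integral,
    Complex.circleIntegral_eq_of_differentiable_on_annulus_off_countable hr hrR countable_empty
      (continuousOn_resolvent a h) fun z hz => ?_]
  refine (spectrum.hasDerivAt_resolvent_const_left (a := a) (k := z) ?_).differentiableAt
  have : z ∈ closedBall c R \ ball c r :=
    ⟨ball_subset_closedBall hz.1.1, fun h => hz.1.2 (ball_subset_closedBall h)⟩
  simpa [spectrum] using disjoint_left.1 h this

/-- Otherwise points of `S` in annuli shrinking onto the circle would accumulate at a point of `S`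
on the circle. -/
theorem exists_annulus_disjoint {S : Set ℂ} (hS : IsClosed S) {c : ℂ} {r : ℝ}
    (h : Disjoint (sphere c r) S) :
    ∃ R, r < R ∧ Disjoint (closedBall c R \ ball c r) S := by
  by_contra! hcon
  have hd : ∀ n : ℕ, ∃ z, r ≤ dist z c ∧ dist z c ≤ r + 1 / (n + 1) ∧ z ∈ S := fun n => by
    obtain ⟨z, hz, hzS⟩ := not_disjoint_iff.1 (hcon (r + 1 / (n + 1)) (by
      have : (0 : ℝ) < 1 / (n + 1) := by positivity
      linarith))
    exact ⟨z, by simpa using hz.2, by simpa using hz.1, hzS⟩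
  choose z h1 h2 h3 using hd
  have hz : ∀ n, z n ∈ closedBall c (r + 1) := fun n => by
    have : (1 : ℝ) / (n + 1) ≤ 1 := by
      rw [div_le_one (by positivity)]; linarith [(Nat.cast_nonneg n : (0 : ℝ) ≤ n)]
    simpa using (h2 n).trans (by linarith)
  obtain ⟨w, -, φ, hφ, hw⟩ := (isCompact_closedBall c (r + 1)).tendsto_subseq hz
  have hwS : w ∈ S := hS.mem_of_tendsto hw (Filter.Eventually.of_forall fun n => h3 _)
  have hlim := (hw.dist (tendsto_const_nhds (x := c)))
  have hle : dist w c ≤ r := by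
    refine le_of_tendsto_of_tendsto' hlim (g := fun n => r + 1 / ((φ n : ℝ) + 1)) ?_ fun n => h2 _
    have := (tendsto_one_div_add_atTop_nhds_zero_nat (𝕜 := ℝ)).comp hφ.tendsto_atTop
    simpa using this.const_add r
  have hge : r ≤ dist w c := ge_of_tendsto' hlim fun n => h1 _
  exact disjoint_left.1 h (mem_sphere.2 (le_antisymm hle hge)) hwS

/-- The product formula needs disjoint contours, so one factor is moved to a slightly larger circle,
which does not change it. -/
theorem Contour.isIdempotentElem_riesz_circle {a : A} {c : ℂ} {r : ℝ} (hr : 0 < r)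
    (hc : Disjoint (sphere c r) (spectrum ℂ a)) :
    IsIdempotentElem ((circle c r).riesz a) := by
  obtain ⟨R, hrR, hR⟩ := exists_annulus_disjoint (spectrum.isClosed a) hc
  have hsub : sphere c R ⊆ closedBall c R \ ball c r := fun z hz =>
    ⟨sphere_subset_closedBall hz, by
      rw [mem_sphere] at hz
      simpa [hz] using hrR.le⟩
  have htr := trace_circle c (hr.trans hrR).le
  have h := (circle c R).riesz_mul_riesz_circle (a := a) hr.le
    (by rw [htr]; exact hR.mono_left hsub)
    (by
      rw [htr]
      refine disjoint_left.2 fun z hz hz' => ?_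
      rw [mem_sphere] at hz
      rw [mem_closedBall, hz] at hz'
      linarith) hc
  rwa [riesz_circle_eq_of_annulus hr hrR.le hR,
    windingNumber_circle_of_mem (mem_ball_self (hr.trans hrR)), one_smul] at h

omit [CompleteSpace A] in
-- Shifting the parameter by `π` turns the circle about `-c` into the pointwise negative of the
-- circle about `c`.
theorem circleIntegral_comp_neg_center (f : ℂ → A) (c : ℂ) (r : ℝ) :
    (∮ z in C(-c, r), f z) = ∮ z in C(c, r), -f (-z) := by
  have hper : Function.Periodic
      (fun θ => deriv (circleMap (-c) r) θ • f (circleMap (-c) r θ)) (2 * Real.pi) := fun θ => by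
    simp only [deriv_circleMap, periodic_circleMap _ _ θ]
  have h1 := hper.intervalIntegral_add_eq 0 Real.pi
  have h4 := intervalIntegral.integral_comp_add_right (a := 0) (b := 2 * Real.pi)
    (fun θ => deriv (circleMap (-c) r) θ • f (circleMap (-c) r θ)) Real.pi
  rw [zero_add] at h1 h4
  rw [circleIntegral, h1, add_comm Real.pi, ← h4, circleIntegral]
  refine intervalIntegral.integral_congr fun θ _ => ?_
  have h2 : ∀ w, circleMap w r (θ + Real.pi) = 2 * w - circleMap w r θ := fun w => by
    simp only [circleMap, Complex.ofReal_add, add_mul, Complex.exp_add, Complex.exp_pi_mul_I]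
    ring
  simp only [deriv_circleMap, h2]
  have h3 : 2 * -c - circleMap (-c) r θ = -circleMap c r θ := by simp only [circleMap]; ring
  rw [h3]
  simp

/-- The Riesz integral commutes with everything that anticommutes with `a`, up to reflecting the
contour. -/
theorem mul_riesz_circle_of_anticommute {a b : A} (hab : b * a = -(a * b)) {c : ℂ} {r : ℝ}
    (hr : 0 ≤ r) (h1 : Disjoint (sphere c r) (spectrum ℂ a))
    (h2 : Disjoint (sphere (-c) r) (spectrum ℂ a)) :
    b * (Contour.circle c r).riesz a = (Contour.circle (-c) r).riesz a * b := by
  have hR1 : ContinuousOn (resolvent a) (ClosedCurve.circle c r).trace := by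
    rw [ClosedCurve.trace_circle c hr]; exact continuousOn_resolvent a h1
  have hR2 : ContinuousOn (resolvent a) (ClosedCurve.circle (-c) r).trace := by
    rw [ClosedCurve.trace_circle _ hr]; exact continuousOn_resolvent a h2
  -- Anticommutation produces one sign here; the substitution `z ↦ -z` in `dz` produces a second,
  -- and they cancel.
  have hneg : ∀ z ∈ sphere c r, b * resolvent a z = -(resolvent a (-z) * b) := fun z hz => by
    have hz2 : -z ∈ sphere (-c) r := by
      rw [mem_sphere] at hz ⊢
      rw [← hz, dist_neg_neg]
    have e1 := Ring.mul_inverse_cancel _ (isUnit_of_notMem_spectrum (disjoint_left.1 h1 hz))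
    have e2 := Ring.inverse_mul_cancel _ (isUnit_of_notMem_spectrum (disjoint_left.1 h2 hz2))
    have e3 : b * (algebraMap ℂ A z - a) = -((algebraMap ℂ A (-z) - a) * b) := by
      rw [mul_sub, hab, ← Algebra.commutes, map_neg]; noncomm_ring
    simp only [resolvent]
    calc b * Ring.inverse (algebraMap ℂ A z - a)
        = Ring.inverse (algebraMap ℂ A (-z) - a) * (algebraMap ℂ A (-z) - a) * b *
            Ring.inverse (algebraMap ℂ A z - a) := by rw [e2, one_mul]
      _ = -(Ring.inverse (algebraMap ℂ A (-z) - a) * (b * (algebraMap ℂ A z - a)) *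
            Ring.inverse (algebraMap ℂ A z - a)) := by rw [e3]; noncomm_ring
      _ = -(Ring.inverse (algebraMap ℂ A (-z) - a) * b) := by
            rw [mul_assoc, mul_assoc, e1, mul_one]
  have key : b * (ClosedCurve.circle c r).integral (resolvent a) =
      (ClosedCurve.circle (-c) r).integral (resolvent a) * b := by
    rw [← ContinuousLinearMap.mul_apply' ℂ A, ← ClosedCurve.integral_clm _ hR1,
      ← ContinuousLinearMap.mul_apply' ℂ A, ← ContinuousLinearMap.flip_apply,
      ← ClosedCurve.integral_clm _ hR2]
    simp only [ContinuousLinearMap.flip_apply, ContinuousLinearMap.mul_apply']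
    rw [ClosedCurve.circle_integral, ClosedCurve.circle_integral,
      circleIntegral.integral_congr hr hneg, circleIntegral_comp_neg_center]
  rw [Contour.riesz, Contour.riesz, mul_smul_comm, smul_mul_assoc]
  simpa [Contour.circle, Contour.integral_cons, Contour.integral_nil] using key

end BanachAlgebra

/-! ### Continuity of the Riesz integral in the operator -/

section Perturbation

variable {A : Type*} [NormedRing A] [NormedAlgebra ℂ A] [CompleteSpace A]

omit [CompleteSpace A] in
theorem tendsto_algebraMap_sub (a : A) (z : ℂ) :
    Tendsto (fun p : A × ℂ => algebraMap ℂ A p.2 - p.1) (𝓝 (a, z)) (𝓝 (algebraMap ℂ A z - a)) := by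
  have : Continuous fun p : A × ℂ => algebraMap ℂ A p.2 - p.1 :=
    ((algebraMapCLM ℂ A).continuous.comp continuous_snd).sub continuous_fst
  exact this.tendsto (a, z)

theorem eventually_disjoint_spectrum {a : A} {S : Set ℂ} (hS : IsCompact S)
    (h : Disjoint S (spectrum ℂ a)) : ∀ᶠ b in 𝓝 a, Disjoint S (spectrum ℂ b) := by
  have key : ∀ᶠ b in 𝓝 a, ∀ z ∈ S, IsUnit (algebraMap ℂ A z - b) := by
    refine hS.eventually_forall_of_forall_eventually fun z hz => ?_
    exact (tendsto_algebraMap_sub a z).eventually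
      (Units.isOpen.mem_nhds (isUnit_of_notMem_spectrum (disjoint_left.1 h hz)))
  filter_upwards [key] with b hb
  exact disjoint_left.2 fun z hz => by simpa [spectrum.mem_iff] using hb z hz

theorem eventually_riesz_circle_close {a : A} {c : ℂ} {r : ℝ} (hr : 0 < r)
    (h : Disjoint (sphere c r) (spectrum ℂ a)) {ε : ℝ} (hε : 0 < ε) :
    ∀ᶠ b in 𝓝 a, ‖(Contour.circle c r).riesz b - (Contour.circle c r).riesz a‖ < ε := by
  have hS := isCompact_sphere c r
  -- Joint continuity of the resolvent and compactness of the circle make this uniform. The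
  -- normalised integral costs a factor `r`, and the `2` keeps the final inequality strict.
  have key : ∀ᶠ b in 𝓝 a, ∀ z ∈ sphere c r, ‖resolvent b z - resolvent a z‖ < ε / (2 * r) := by
    refine hS.eventually_forall_of_forall_eventually fun z hz => ?_
    have hu := isUnit_of_notMem_spectrum (disjoint_left.1 h hz)
    have h1 : Tendsto (fun p : A × ℂ => resolvent p.1 p.2) (𝓝 (a, z)) (𝓝 (resolvent a z)) := by
      have := NormedRing.inverse_continuousAt hu.unit
      exact (this.tendsto).comp (tendsto_algebraMap_sub a z)
    have h2 : Tendsto (fun p : A × ℂ => resolvent a p.2) (𝓝 (a, z)) (𝓝 (resolvent a z)) := by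
      have hc : ContinuousAt (resolvent a) z :=
        (spectrum.hasDerivAt_resolvent_const_left (a := a) (k := z)
          (by simpa [spectrum] using disjoint_left.1 h hz)).continuousAt
      exact hc.tendsto.comp (continuous_snd.tendsto (a, z))
    have h3 := (h1.sub h2).norm
    rw [sub_self, norm_zero] at h3
    exact h3.eventually (gt_mem_nhds (by positivity))
  filter_upwards [key, eventually_disjoint_spectrum hS h] with b hb hbs
  have hcb := (continuousOn_resolvent b hbs).circleIntegrable hr.le
  have hca := (continuousOn_resolvent a h).circleIntegrable hr.le
  rw [Contour.riesz, Contour.riesz, Contour.circle_integral, Contour.circle_integral, ← smul_sub,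
    ← circleIntegral.integral_sub hcb hca]
  refine (circleIntegral.norm_two_pi_i_inv_smul_integral_le_of_norm_le_const hr.le
    fun z hz => (hb z hz).le).trans_lt ?_
  field_simp
  linarith

end Perturbation

/-! ### Ranks of Riesz idempotents and their action on root vectors -/

section Hilbert

variable {H : Type*} [NormedAddCommGroup H] [InnerProductSpace ℂ H] [CompleteSpace H]

/-- The algebraic (generalised) eigenspace of `T` at `μ`. -/
def rootSpace (T : H →L[ℂ] H) (μ : ℂ) : Submodule ℂ H :=
  Module.End.maxGenEigenspace (T : H →ₗ[ℂ] H) μ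

/-- The range of a bounded operator, as a linear subspace. -/
abbrev rangeOf (T : H →L[ℂ] H) : Submodule ℂ H := LinearMap.range (T : H →ₗ[ℂ] H)

omit [CompleteSpace H] in
theorem IsIdempotentElem.apply_of_mem_rangeOf {E : H →L[ℂ] H} (hE : IsIdempotentElem E) {x : H}
    (hx : x ∈ rangeOf E) : E x = x := by
  obtain ⟨y, rfl⟩ := hx
  exact DFunLike.congr_fun hE.eq y

omit [CompleteSpace H] in
-- `F` is injective on the range of `E`: if `E x = x` and `F x = 0`, then `‖x‖ ≤ ‖F - E‖ ‖x‖`.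
theorem rank_rangeOf_le_of_norm_sub_lt {E F : H →L[ℂ] H} (hE : IsIdempotentElem E)
    (h : ‖F - E‖ < 1) : Module.rank ℂ (rangeOf E) ≤ Module.rank ℂ (rangeOf F) := by
  let L : rangeOf E →ₗ[ℂ] rangeOf F :=
    ((F : H →ₗ[ℂ] H).rangeRestrict).comp (rangeOf E).subtype
  refine LinearMap.rank_le_of_injective L ?_
  rw [injective_iff_map_eq_zero]
  rintro ⟨x, hx⟩ hLx
  have h0 : F x = 0 := congrArg Subtype.val hLx
  have h1 := hE.apply_of_mem_rangeOf hx
  have h2 : ‖x‖ ≤ ‖F - E‖ * ‖x‖ := by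
    have := (F - E).le_opNorm x
    rwa [sub_apply, h0, h1, zero_sub, norm_neg] at this
  have h3 : x = 0 := by
    by_contra hne
    have := norm_pos_iff.2 hne
    nlinarith
  simpa using h3

theorem eventually_rank_riesz_circle_eq {T : H →L[ℂ] H} {c : ℂ} {r : ℝ} (hr : 0 < r)
    (h : Disjoint (sphere c r) (spectrum ℂ T)) :
    ∀ᶠ S in 𝓝 T, Disjoint (sphere c r) (spectrum ℂ S) ∧
      Module.rank ℂ (rangeOf ((Contour.circle c r).riesz S)) =
        Module.rank ℂ (rangeOf ((Contour.circle c r).riesz T)) := by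
  filter_upwards [eventually_disjoint_spectrum (isCompact_sphere c r) h,
    eventually_riesz_circle_close hr h one_pos] with S hS hclose
  refine ⟨hS, le_antisymm ?_ ?_⟩
  · rw [norm_sub_rev] at hclose
    exact rank_rangeOf_le_of_norm_sub_lt (Contour.isIdempotentElem_riesz_circle hr hS) hclose
  · exact rank_rangeOf_le_of_norm_sub_lt (Contour.isIdempotentElem_riesz_circle hr h) hclose

theorem resolvent_apply_eq_iff {T : H →L[ℂ] H} {z : ℂ} (hz : z ∉ spectrum ℂ T) {x y : H} :
    resolvent T z x = y ↔ x = z • y - T y := by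
  have hu := isUnit_of_notMem_spectrum hz
  have h1 : (algebraMap ℂ (H →L[ℂ] H) z - T) y = z • y - T y := by
    simp [Algebra.algebraMap_eq_smul_one]
  rw [← h1]
  constructor
  · rintro rfl
    exact (DFunLike.congr_fun (Ring.mul_inverse_cancel _ hu) x).symm
  · rintro rfl
    exact DFunLike.congr_fun (Ring.inverse_mul_cancel _ hu) y

omit [CompleteSpace H] in
theorem mem_rootSpace {T : H →L[ℂ] H} {μ : ℂ} {x : H} :
    x ∈ rootSpace T μ ↔ ∃ k : ℕ, ((T - μ • 1 : H →L[ℂ] H) ^ k) x = 0 := by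
  rw [rootSpace, Module.End.mem_maxGenEigenspace]
  have : ∀ k : ℕ, (((T : H →ₗ[ℂ] H) - μ • 1) ^ k) x = ((T - μ • 1 : H →L[ℂ] H) ^ k) x := fun k => by
    have h : (((T - μ • 1 : H →L[ℂ] H)) : H →ₗ[ℂ] H) = (T : H →ₗ[ℂ] H) - μ • 1 := by
      ext; simp
    rw [← h, ← ContinuousLinearMap.toLinearMap_pow]
    rfl
  simp only [this]

theorem Contour.integral_apply (Γ : Contour) {f : ℂ → H →L[ℂ] H} (hf : ContinuousOn f Γ.trace)
    (x : H) : Γ.integral f x = Γ.integral fun z => f z x :=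
  (Γ.integral_clm hf (ContinuousLinearMap.apply ℂ H x)).symm

/-- The Riesz integral acts on an algebraic eigenspace as the winding number of the contour. -/
theorem Contour.riesz_apply_of_mem_rootSpace (Γ : Contour) {T : H →L[ℂ] H} {μ : ℂ}
    (hΓ : Disjoint Γ.trace (spectrum ℂ T)) (hμ : μ ∉ Γ.trace) {x : H} (hx : x ∈ rootSpace T μ) :
    Γ.riesz T x = Γ.windingNumber μ • x := by
  obtain ⟨k, hk⟩ := mem_rootSpace.1 hx
  set N : H →L[ℂ] H := T - μ • 1 with hN
  -- Raising the exponent keeps the Laurent sum below nonempty, so that it always contains the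
  -- simple pole.
  replace hk : (N ^ (k + 1)) x = 0 := by rw [pow_succ', mul_apply_eq_comp, hk, map_zero]
  have hT : ∀ y, T y = N y + μ • y := fun y => by simp [hN]
  have hne : ∀ z ∈ Γ.trace, z - μ ≠ 0 := fun z hz h => hμ (sub_eq_zero.1 h ▸ hz)
  have hsum : ∀ z ∈ Γ.trace, resolvent T z x =
      ∑ j ∈ Finset.range (k + 1), ((z - μ) ^ (j + 1))⁻¹ • (N ^ j) x := fun z hz => by
    rw [resolvent_apply_eq_iff (disjoint_left.1 hΓ hz), hT]
    have h1 : ∀ n : ℕ, (z - μ) • (∑ j ∈ Finset.range n, ((z - μ) ^ (j + 1))⁻¹ • (N ^ j) x) -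
        N (∑ j ∈ Finset.range n, ((z - μ) ^ (j + 1))⁻¹ • (N ^ j) x) =
        x - ((z - μ) ^ n)⁻¹ • (N ^ n) x := fun n => by
      induction n with
      | zero => simp
      | succ n ih =>
        rw [Finset.sum_range_succ, smul_add, map_add, add_sub_add_comm, ih, map_smul, smul_smul]
        have h2 : N ((N ^ n) x) = (N ^ (n + 1)) x := by rw [pow_succ']; rfl
        have h3 : (z - μ) * ((z - μ) ^ (n + 1))⁻¹ = ((z - μ) ^ n)⁻¹ := by
          have := hne z hz
          rw [pow_succ']
          field_simp
        rw [h2, h3]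
        abel
    have h4 := h1 (k + 1)
    rw [hk, smul_zero, sub_zero] at h4
    conv_lhs => rw [← h4, sub_smul]
    abel
  have hcj : ∀ j : ℕ, ContinuousOn (fun z : ℂ => ((z - μ) ^ (j + 1))⁻¹) Γ.trace := fun j =>
    ((continuousOn_id.sub continuousOn_const).pow _).inv₀ fun z hz => pow_ne_zero _ (hne z hz)
  have hint : ∀ n : ℕ, Γ.integral (fun z => ∑ j ∈ Finset.range (n + 1),
      ((z - μ) ^ (j + 1))⁻¹ • (N ^ j) x) = Γ.integral (fun z => (z - μ)⁻¹) • x := fun n => by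
    induction n with
    | zero =>
      simp only [zero_add, Finset.range_one, Finset.sum_singleton, pow_one, pow_zero, one_apply_eq_self]
      exact Γ.integral_smul_const (by simpa using hcj 0) x
    | succ n ih =>
      simp only [Finset.sum_range_succ _ (n + 1)]
      rw [Γ.integral_add, ih, Γ.integral_smul_const (hcj _)]
      -- Poles of order at least two have primitives and drop out; only the simple pole contributes.
      · have h5 : Γ.integral (fun z => ((z - μ) ^ (n + 1 + 1))⁻¹) = 0 := by
          refine Γ.integral_eq_zero_of_hasDerivAt
            (f := fun z => -((n + 1 : ℂ))⁻¹ * ((z - μ) ^ (n + 1))⁻¹) (hcj _) fun z hz => ?_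
          have h6 := (((hasDerivAt_id z).sub_const μ).pow (n + 1)).inv (pow_ne_zero _ (hne z hz))
          refine (h6.const_mul (-((n + 1 : ℂ))⁻¹)).congr_deriv ?_
          have h7 := hne z hz
          have h8 : (n + 1 : ℂ) ≠ 0 := by exact_mod_cast n.succ_ne_zero
          simp only [id, Pi.pow_apply, Nat.cast_add, Nat.cast_one, Nat.add_sub_cancel]
          field_simp
          ring
        rw [h5, zero_smul, add_zero]
      · exact continuousOn_finsetSum _ fun j _ => (hcj j).smul continuousOn_const
      · exact (hcj _).smul continuousOn_const
  rw [Contour.riesz, smul_apply, Γ.integral_apply (continuousOn_resolvent T hΓ),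
    Γ.integral_congr hsum, hint, Contour.windingNumber, smul_smul]

end Hilbert

/-! ### Riesz integrals and the commutant -/

section Commute

variable {A : Type*} [NormedRing A] [NormedAlgebra ℂ A] [CompleteSpace A]

theorem Contour.commute_riesz (Γ : Contour) {a b : A} (hΓ : Disjoint Γ.trace (spectrum ℂ a))
    (h : Commute a b) : Commute (Γ.riesz a) b := by
  have hR := continuousOn_resolvent a hΓ
  have hz : ∀ z, Commute (algebraMap ℂ A z - a) b := fun z =>
    Commute.sub_left (Algebra.commutes z b) h
  have key : Γ.integral (resolvent a) * b = b * Γ.integral (resolvent a) := by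
    rw [← ContinuousLinearMap.mul_apply' ℂ A b, ← ContinuousLinearMap.mul_apply' ℂ A,
      ← ContinuousLinearMap.flip_apply, ← Γ.integral_clm hR, ← Γ.integral_clm hR]
    refine Γ.integral_congr fun z hzΓ => ?_
    obtain ⟨u, hu⟩ := isUnit_of_notMem_spectrum (disjoint_left.1 hΓ hzΓ)
    have h1 := hz z
    simp only [ContinuousLinearMap.flip_apply, ContinuousLinearMap.mul_apply', resolvent]
    rw [← hu] at h1 ⊢
    rw [Ring.inverse_unit]
    exact h1.units_inv_left.eq
  rw [Commute, SemiconjBy, Contour.riesz, smul_mul_assoc, mul_smul_comm, key]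

end Commute

/-! ### Spectral theory of compact operators and weak balance -/

section Compact

variable {H : Type*} [NormedAddCommGroup H] [InnerProductSpace ℂ H] [CompleteSpace H]

/-- Riesz's argument: orthonormalise eigenvectors for infinitely many eigenvalues of modulus at
least `ε`. Then `K (u n)` equals `e n • u n` modulo the span of the earlier vectors, which `K`
preserves, so the images `K (u n)` stay `ε` apart, contrary to compactness. -/
theorem IsCompactOperator.finite_spectrum_norm_ge {K : H →L[ℂ] H} (hK : IsCompactOperator K)
    {ε : ℝ} (hε : 0 < ε) : {z ∈ spectrum ℂ K | ε ≤ ‖z‖}.Finite := by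
  by_contra hinf
  let e := Set.Infinite.natEmbedding _ hinf
  have hev : ∀ n, Module.End.HasEigenvalue (K : H →ₗ[ℂ] H) (e n : ℂ) := fun n =>
    (hK.hasEigenvalue_iff_mem_spectrum (norm_pos_iff.1 (hε.trans_le (e n).2.2))).2 (e n).2.1
  choose v hv using fun n => (hev n).exists_hasEigenvector
  have hli : LinearIndependent ℂ v := Module.End.eigenvectors_linearIndependent' _
    (fun n => (e n : ℂ)) (Subtype.val_injective.comp e.injective) v hv
  set u := InnerProductSpace.gramSchmidtNormed ℂ v with hu
  have hon : Orthonormal ℂ u := InnerProductSpace.gramSchmidtNormed_orthonormal hli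
  have humem : ∀ n, u n ∈ Submodule.span ℂ (v '' Iic n) := fun n => by
    rw [hu, InnerProductSpace.gramSchmidtNormed]
    exact Submodule.smul_mem _ _ (InnerProductSpace.gramSchmidt_mem_span _ _ le_rfl)
  have horth : ∀ n, ∀ y ∈ Submodule.span ℂ (v '' Iio n), inner ℂ (u n) y = 0 := fun n y hy => by
    rw [← InnerProductSpace.span_gramSchmidt_Iio] at hy
    induction hy using Submodule.span_induction with
    | mem y hy =>
      obtain ⟨m, hm, rfl⟩ := hy
      rw [hu, InnerProductSpace.gramSchmidtNormed, inner_smul_left,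
        InnerProductSpace.gramSchmidt_orthogonal ℂ v (ne_of_gt hm), mul_zero]
    | zero => simp
    | add y z _ _ hy hz => rw [inner_add_right, hy, hz, add_zero]
    | smul a y _ hy => rw [inner_smul_right, hy, mul_zero]
  have hKv : ∀ n, K (v n) = (e n : ℂ) • v n := fun n => (hv n).apply_eq_smul
  have hKle : ∀ n, ∀ y ∈ Submodule.span ℂ (v '' Iic n), K y ∈ Submodule.span ℂ (v '' Iic n) := by
    intro n y hy
    induction hy using Submodule.span_induction with
    | mem y hy =>
      obtain ⟨m, hm, rfl⟩ := hy
      rw [hKv]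
      exact Submodule.smul_mem _ _ (Submodule.subset_span (mem_image_of_mem v hm))
    | zero => simp
    | add y z _ _ hy hz => rw [map_add]; exact add_mem hy hz
    | smul a y _ hy => rw [map_smul]; exact Submodule.smul_mem _ _ hy
  have hKlt : ∀ n, ∀ y ∈ Submodule.span ℂ (v '' Iic n),
      K y - (e n : ℂ) • y ∈ Submodule.span ℂ (v '' Iio n) := by
    intro n y hy
    induction hy using Submodule.span_induction with
    | mem y hy =>
      obtain ⟨m, hm, rfl⟩ := hy
      rw [hKv, ← sub_smul]
      rcases (mem_Iic.1 hm).eq_or_lt with rfl | hlt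
      · simp
      · exact Submodule.smul_mem _ _ (Submodule.subset_span (mem_image_of_mem v hlt))
    | zero => simp
    | add y z _ _ hy hz =>
      have := add_mem hy hz
      rwa [← add_sub_add_comm, ← smul_add, ← map_add] at this
    | smul a y _ hy =>
      have := Submodule.smul_mem _ a hy
      rwa [smul_sub, ← map_smul, smul_comm] at this
  have hsep : ∀ m n, m < n → ε ≤ ‖K (u n) - K (u m)‖ := fun m n hmn => by
    have h1 := horth n _ (hKlt n _ (humem n))
    have h2 := horth n _ (Submodule.span_mono (image_mono (Iic_subset_Iio.2 hmn))
      (hKle m _ (humem m)))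
    have h3 : inner ℂ (u n) (K (u n) - K (u m)) = (e n : ℂ) := by
      rw [inner_sub_right, h2, sub_zero]
      rw [inner_sub_right, inner_smul_right, inner_self_eq_norm_sq_to_K, hon.1 n] at h1
      simpa [sub_eq_zero] using h1
    calc ε ≤ ‖(e n : ℂ)‖ := (e n).2.2
      _ = ‖inner ℂ (u n) (K (u n) - K (u m))‖ := by rw [h3]
      _ ≤ ‖u n‖ * ‖K (u n) - K (u m)‖ := norm_inner_le_norm _ _
      _ = _ := by rw [hon.1 n, one_mul]
  obtain ⟨C, hC, hKC⟩ := hK.image_closedBall_subset_compact (f := (K : H →ₗ[ℂ] H)) 1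
  obtain ⟨w, -, φ, hφ, hw⟩ := hC.tendsto_subseq (x := fun n => K (u n)) fun n =>
    hKC (mem_image_of_mem _ (by simp [hon.1 n]))
  obtain ⟨N, hN⟩ := Metric.cauchySeq_iff'.1 hw.cauchySeq ε hε
  have := hN (N + 1) (Nat.le_succ N)
  rw [dist_eq_norm] at this
  exact absurd (hsep _ _ (hφ (Nat.lt_succ_self N))) (not_le.2 this)

theorem IsCompactOperator.exists_sphere_disjoint {K : H →L[ℂ] H} (hK : IsCompactOperator K)
    {ε : ℝ} (hε : 0 < ε) : ∃ δ, 0 < δ ∧ δ < ε ∧ Disjoint (sphere (0 : ℂ) δ) (spectrum ℂ K) := by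
  have hf := (hK.finite_spectrum_norm_ge (half_pos hε)).image norm
  -- Only finitely many radii in `(ε / 2, ε)` are moduli of spectral points.
  obtain ⟨δ, ⟨h1, h2⟩, h3⟩ := ((Ioo_infinite (half_lt_self hε)).sdiff hf).nonempty
  refine ⟨δ, (half_pos hε).trans h1, h2, disjoint_left.2 fun z hz hzK => h3 ⟨z, ⟨hzK, ?_⟩, ?_⟩⟩
  · rw [mem_sphere_zero_iff_norm] at hz; rw [hz]; exact h1.le
  · simpa using hz

/-- Since `R(z) = z⁻¹ + z⁻¹ K R(z)` for the resolvent `R`, and the first term integrates to the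
identity, the rest is `K` times a bounded operator. -/
theorem IsCompactOperator.isCompactOperator_one_sub_riesz {K : H →L[ℂ] H}
    (hK : IsCompactOperator K) {δ : ℝ} (hδ : 0 < δ)
    (h : Disjoint (sphere (0 : ℂ) δ) (spectrum ℂ K)) :
    IsCompactOperator (1 - (Contour.circle 0 δ).riesz K : H →L[ℂ] H) := by
  have hR := continuousOn_resolvent K h
  have hne : ∀ z ∈ sphere (0 : ℂ) δ, z ≠ 0 := fun z hz h0 => by
    rw [h0, mem_sphere_zero_iff_norm, norm_zero] at hz
    exact hδ.ne hz
  have hinv : ContinuousOn (fun z : ℂ => z⁻¹) (sphere (0 : ℂ) δ) := continuousOn_id.inv₀ hne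
  rw [← ClosedCurve.trace_circle _ hδ.le] at hR hinv
  set η := ClosedCurve.circle 0 δ with hη
  have h1 : η.integral (resolvent K) = (2 * Real.pi * Complex.I : ℂ) • (1 : H →L[ℂ] H) +
      K * η.integral (fun z => z⁻¹ • resolvent K z) := by
    rw [← ContinuousLinearMap.mul_apply' ℂ (H →L[ℂ] H), ← η.integral_clm (f := fun z => z⁻¹ • resolvent K z) (hinv.smul hR)]
    have h2 : η.integral (fun z => z⁻¹ • (1 : H →L[ℂ] H)) =
        (2 * Real.pi * Complex.I : ℂ) • (1 : H →L[ℂ] H) := by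
      have h3 := η.integral_clm hinv (ContinuousLinearMap.smulRight (1 : ℂ →L[ℂ] ℂ) (1 : H →L[ℂ] H))
      simp only [ContinuousLinearMap.smulRight_apply, one_apply_eq_self] at h3
      rw [h3, hη, ClosedCurve.circle_integral]
      have := circleIntegral.integral_sub_center_inv 0 hδ.ne'
      simp only [sub_zero] at this
      rw [this]
    rw [← h2, ← η.integral_add (f := fun z => z⁻¹ • (1 : H →L[ℂ] H))
      (g := fun z => ContinuousLinearMap.mul ℂ (H →L[ℂ] H) K (z⁻¹ • resolvent K z))
      (hinv.smul continuousOn_const)]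
    · refine η.integral_congr fun z hz => ?_
      rw [hη, ClosedCurve.trace_circle _ hδ.le] at hz
      have h4 := Ring.mul_inverse_cancel _ (isUnit_of_notMem_spectrum (disjoint_left.1 h hz))
      simp only [ContinuousLinearMap.mul_apply', mul_smul_comm, ← smul_add]
      rw [sub_mul, sub_eq_iff_eq_add, Algebra.algebraMap_eq_smul_one, smul_mul_assoc, one_mul] at h4
      have h5 : (1 : H →L[ℂ] H) + K * resolvent K z = z • resolvent K z := by
        simp only [resolvent, Algebra.algebraMap_eq_smul_one] at h4 ⊢
        exact h4.symm
      rw [h5, smul_smul, inv_mul_cancel₀ (hne z hz), one_smul]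
    · exact (ContinuousLinearMap.continuous _).comp_continuousOn (hinv.smul hR)
  have h6 : (1 - (Contour.circle 0 δ).riesz K : H →L[ℂ] H) =
      K * (-(2 * Real.pi * Complex.I : ℂ)⁻¹ • η.integral (fun z => z⁻¹ • resolvent K z)) := by
    rw [Contour.riesz, Contour.integral_cons, Contour.integral_nil, add_zero, ← hη, h1, smul_add,
      smul_smul, inv_mul_cancel₀ Complex.two_pi_I_ne_zero, one_smul, mul_smul_comm]
    simp
  rw [h6]
  exact hK.comp_clm _

omit [CompleteSpace H] in
-- On its closed range the idempotent is the identity, and a compact identity forces finite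
-- dimension.
theorem IsIdempotentElem.finiteDimensional_rangeOf {E : H →L[ℂ] H} (hE : IsIdempotentElem E)
    (hc : IsCompactOperator E) : FiniteDimensional ℂ (rangeOf E) := by
  have hcl : IsClosed (rangeOf E : Set H) := by
    have : (rangeOf E : Set H) = {x | E x = x} := by
      ext x
      exact ⟨fun hx => hE.apply_of_mem_rangeOf hx, fun hx => ⟨x, hx⟩⟩
    rw [this]
    exact isClosed_eq E.continuous continuous_id
  have hmaps : ∀ x ∈ rangeOf E, (E : H →ₗ[ℂ] H) x ∈ rangeOf E := fun x _ => ⟨x, rfl⟩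
  have h1 := IsCompactOperator.restrict (f := (E : H →ₗ[ℂ] H)) hc hmaps hcl
  have h2 : (((E : H →ₗ[ℂ] H).restrict hmaps : rangeOf E →ₗ[ℂ] rangeOf E) :
      rangeOf E → rangeOf E) = id := by
    ext x
    exact hE.apply_of_mem_rangeOf x.2
  rw [h2] at h1
  exact FiniteDimensional.of_isCompactOperator_id (𝕜 := ℂ) h1

omit [CompleteSpace H] in
theorem rangeOf_le_iSup_rootSpace {T Q : H →L[ℂ] H} [FiniteDimensional ℂ (rangeOf Q)]
    (h : Commute T Q) : rangeOf Q ≤ ⨆ μ, rootSpace T μ := by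
  have hmaps : ∀ x ∈ rangeOf Q, (T : H →ₗ[ℂ] H) x ∈ rangeOf Q := by
    rintro _ ⟨y, rfl⟩
    exact ⟨T y, (DFunLike.congr_fun h.eq y).symm⟩
  have h1 := Module.End.iSup_maxGenEigenspace_eq_top ((T : H →ₗ[ℂ] H).restrict hmaps)
  calc rangeOf Q = Submodule.map (rangeOf Q).subtype ⊤ := by simp
    _ = ⨆ μ, Submodule.map (rangeOf Q).subtype
          (Module.End.maxGenEigenspace ((T : H →ₗ[ℂ] H).restrict hmaps) μ) := by
        rw [← h1, Submodule.map_iSup]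
    _ ≤ ⨆ μ, rootSpace T μ := by
        refine iSup_mono fun μ => ?_
        rw [Module.End.maxGenEigenspace, Module.End.genEigenspace_restrict]
        exact Submodule.map_comap_le _ _

omit [CompleteSpace H] in
theorem mem_spectrum_of_mem_rootSpace {T : H →L[ℂ] H} {μ : ℂ} {x : H} (hx : x ∈ rootSpace T μ)
    (h0 : x ≠ 0) : μ ∈ spectrum ℂ T := by
  obtain ⟨k, hk⟩ := mem_rootSpace.1 hx
  rw [spectrum.mem_iff]
  intro hu
  have hu2 : IsUnit ((T - μ • 1) ^ k) := by
    refine IsUnit.pow k ?_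
    rw [← IsUnit.neg_iff, neg_sub]
    simpa [Algebra.algebraMap_eq_smul_one] using hu
  obtain ⟨U, hU⟩ := hu2
  rw [← hU] at hk
  have : ((↑U⁻¹ : H →L[ℂ] H) * ↑U) x = 0 := by rw [mul_apply_eq_comp, hk, map_zero]
  rw [Units.inv_mul] at this
  exact h0 this

theorem Contour.Separates.riesz_apply {Γ : Contour} {T : H →L[ℂ] H} {Ω : Set ℂ}
    (h : Γ.Separates T Ω) {μ : ℂ} {x : H} (hx : x ∈ rootSpace T μ) :
    (μ ∈ Ω → Γ.riesz T x = x) ∧ (μ ∉ Ω → Γ.riesz T x = 0) := by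
  by_cases h0 : x = 0
  · simp [h0]
  have hμ := mem_spectrum_of_mem_rootSpace hx h0
  have h1 := Γ.riesz_apply_of_mem_rootSpace h.1 (disjoint_right.1 h.1 hμ) hx
  exact ⟨fun hΩ => by rw [h1, h.2.1 μ ⟨hμ, hΩ⟩, one_smul],
    fun hΩ => by rw [h1, h.2.2 μ ⟨hμ, hΩ⟩, zero_smul]⟩

omit [CompleteSpace H] in
theorem IsCompactOperator.zero_mem_spectrum {K : H →L[ℂ] H} (hK : IsCompactOperator K)
    (hH : ¬ FiniteDimensional ℂ H) : (0 : ℂ) ∈ spectrum ℂ K := by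
  rw [spectrum.mem_iff, map_zero, zero_sub, IsUnit.neg_iff]
  rintro ⟨U, rfl⟩
  have h1 : IsCompactOperator ((U : H →L[ℂ] H) * (↑U⁻¹ : H →L[ℂ] H) : H →L[ℂ] H) :=
    hK.comp_clm _
  rw [Units.mul_inv] at h1
  exact hH (FiniteDimensional.of_isCompactOperator_id (𝕜 := ℂ) h1)

/-- The spectral picture of a compact operator on an infinite-dimensional space near `0`. -/
theorem IsCompactOperator.exists_riesz_circle {K : H →L[ℂ] H} (hK : IsCompactOperator K)
    {ε : ℝ} (hε : 0 < ε) : ∃ δ, 0 < δ ∧ δ < ε ∧ Disjoint (sphere (0 : ℂ) δ) (spectrum ℂ K) ∧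
      FiniteDimensional ℂ (rangeOf (1 - (Contour.circle 0 δ).riesz K)) ∧
      rangeOf (1 - (Contour.circle 0 δ).riesz K) ≤ ⨆ μ, rootSpace K μ := by
  obtain ⟨δ, h0, h1, h2⟩ := hK.exists_sphere_disjoint hε
  have h3 := ((Contour.isIdempotentElem_riesz_circle h0 h2).one_sub).finiteDimensional_rangeOf
    (hK.isCompactOperator_one_sub_riesz h0 h2)
  refine ⟨δ, h0, h1, h2, h3, rangeOf_le_iSup_rootSpace ?_⟩
  refine (Commute.one_right K).sub_right ?_
  exact ((Contour.circle 0 δ).commute_riesz (by rwa [Contour.trace_circle _ h0.le])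
    (Commute.refl K)).symm

theorem IsCompactOperator.finiteDimensional_rootSpace {K : H →L[ℂ] H} (hK : IsCompactOperator K)
    {μ : ℂ} (hμ : μ ≠ 0) : FiniteDimensional ℂ (rootSpace K μ) := by
  obtain ⟨δ, h0, h1, h2, h3, -⟩ := hK.exists_riesz_circle (norm_pos_iff.2 hμ)
  refine Submodule.finiteDimensional_of_le (S₂ := rangeOf (1 - (Contour.circle 0 δ).riesz K))
    fun x hx => ⟨x, ?_⟩
  have h4 : μ ∉ closedBall (0 : ℂ) δ := by simpa using h1
  have h5 := (Contour.circle 0 δ).riesz_apply_of_mem_rootSpace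
    (by rwa [Contour.trace_circle _ h0.le])
    (by rw [Contour.trace_circle _ h0.le]; exact fun h => h4 (sphere_subset_closedBall h)) hx
  rw [Contour.windingNumber_circle_of_notMem h0.le h4, zero_smul] at h5
  simp [h5]

theorem exists_closedBall_disjoint_trace (Γ : Contour) {w : ℂ} (hw : w ∉ Γ.trace) :
    ∃ ε > 0, ∀ δ < ε, Disjoint Γ.trace (closedBall w δ) := by
  obtain ⟨ε, hε, h⟩ := Metric.isOpen_iff.1 Γ.isCompact_trace.isClosed.isOpen_compl w hw
  exact ⟨ε, hε, fun δ hδ => disjoint_left.2 fun z hz hz' =>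
    h (closedBall_subset_ball hδ hz') hz⟩

/-- The Riesz integral is `1` or `0` on each root space, so it remains to reduce to sums of root
vectors. In infinite dimension, split off the part of the vector belonging to a small circle about
`0`: the contour does not wind around `0`, hence kills it, and the complementary part is a finite
sum of root vectors. In finite dimension root vectors span everything. -/
theorem IsCompactOperator.rangeOf_riesz {K : H →L[ℂ] H} (hK : IsCompactOperator K)
    {Γ : Contour} {Ω : Set ℂ} (h : Γ.Separates K Ω) (hΩ : FiniteDimensional ℂ H ∨ (0 : ℂ) ∉ Ω) :
    rangeOf (Γ.riesz K) = ⨆ μ : Ω, rootSpace K μ := by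
  have key : ∀ x, ∃ y ∈ ⨆ μ, rootSpace K μ, Γ.riesz K x = Γ.riesz K y := by
    intro x
    by_cases hH : FiniteDimensional ℂ H
    · refine ⟨x, ?_, rfl⟩
      have : (⨆ μ, rootSpace K μ) = ⊤ := Module.End.iSup_maxGenEigenspace_eq_top (K : H →ₗ[ℂ] H)
      rw [this]
      trivial
    · have hσ := hK.zero_mem_spectrum hH
      obtain ⟨ε, hε, hd⟩ := exists_closedBall_disjoint_trace Γ (disjoint_right.1 h.1 hσ)
      obtain ⟨δ, h0, h1, h2, h3, h4⟩ := hK.exists_riesz_circle hε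
      refine ⟨_, h4 ⟨x, rfl⟩, ?_⟩
      have h5 := Γ.riesz_mul_riesz_circle h0.le h.1 (hd δ h1) h2
      rw [h.2.2 0 ⟨hσ, hΩ.resolve_left hH⟩, zero_smul] at h5
      have h6 : Γ.riesz K ((Contour.circle 0 δ).riesz K x) = 0 := DFunLike.congr_fun h5 x
      simp [h6]
  apply le_antisymm
  · rintro _ ⟨x, rfl⟩
    obtain ⟨y, hy, hxy⟩ := key x
    show Γ.riesz K x ∈ _
    rw [hxy]
    clear hxy
    induction hy using Submodule.iSup_induction' with
    | mem μ y hy =>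
      by_cases hμ : μ ∈ Ω
      · rw [(h.riesz_apply hy).1 hμ]
        exact Submodule.mem_iSup_of_mem (⟨μ, hμ⟩ : Ω) hy
      · rw [(h.riesz_apply hy).2 hμ]
        exact zero_mem _
    | zero => simp
    | add y z _ _ hy hz => rw [map_add]; exact add_mem hy hz
  · exact iSup_le fun μ x hx => ⟨x, (h.riesz_apply hx).1 μ.2⟩

/-- The range contains that of the Riesz idempotent over a small circle about `0`, which has a
finite-dimensional complement. -/
theorem IsCompactOperator.hilbertDim_rangeOf_riesz {K : H →L[ℂ] H} (hK : IsCompactOperator K)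
    {Γ : Contour} {Ω : Set ℂ} (h : Γ.Separates K Ω) (hH : ¬ FiniteDimensional ℂ H)
    (hΩ : (0 : ℂ) ∈ Ω) : hilbertDim (rangeOf (Γ.riesz K)) = ⊤ := by
  have hσ := hK.zero_mem_spectrum hH
  obtain ⟨ε, hε, hd⟩ := exists_closedBall_disjoint_trace Γ (disjoint_right.1 h.1 hσ)
  obtain ⟨δ, h0, h1, h2, h3, -⟩ := hK.exists_riesz_circle hε
  have h5 := Γ.riesz_mul_riesz_circle h0.le h.1 (hd δ h1) h2
  rw [h.2.1 0 ⟨hσ, hΩ⟩, one_smul] at h5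
  rw [hilbertDim, Cardinal.toENat_eq_top]
  by_contra hlt
  have hfin : FiniteDimensional ℂ (rangeOf (Γ.riesz K)) :=
    Module.rank_lt_aleph0_iff.1 (not_le.1 hlt)
  apply hH
  have h7 : rangeOf (Γ.riesz K) ⊔ rangeOf (1 - (Contour.circle 0 δ).riesz K) = ⊤ := by
    rw [eq_top_iff]
    intro x _
    refine Submodule.mem_sup.2 ⟨(Contour.circle 0 δ).riesz K x,
      ⟨(Contour.circle 0 δ).riesz K x, DFunLike.congr_fun h5 x⟩, _, ⟨x, rfl⟩, ?_⟩
    simp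
  have h8 : FiniteDimensional ℂ (⊤ : Submodule ℂ H) := by
    rw [← h7]; infer_instance
  exact Module.Finite.equiv (Submodule.topEquiv (R := ℂ) (M := H))

/-- The algebraic multiplicities of `T` at `μ` and `-μ` agree. -/
def HasSymmetricRoots (T : H →L[ℂ] H) : Prop :=
  ∀ μ : ℂ, Module.rank ℂ (rootSpace T μ) = Module.rank ℂ (rootSpace T (-μ))

omit [CompleteSpace H] in
theorem rank_iSup_rootSpace (T : H →L[ℂ] H) (Ω : Set ℂ) :
    Module.rank ℂ (⨆ μ : Ω, rootSpace T μ : Submodule ℂ H) =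
      Cardinal.sum fun μ : Ω => Module.rank ℂ (rootSpace T μ) := by
  have hind : iSupIndep fun μ : Ω => rootSpace T μ :=
    (Module.End.independent_maxGenEigenspace (T : H →ₗ[ℂ] H)).comp Subtype.val_injective
  rw [Submodule.iSup_eq_range_dfinsupp_lsum,
    ← (LinearEquiv.ofInjective _ hind.dfinsupp_lsum_injective).rank_eq]
  exact rank_directSum ℂ fun μ : Ω => rootSpace T μ

theorem HasSymmetricRoots.isWeaklyBalanced {K : H →L[ℂ] H} (hK : IsCompactOperator K)
    (h : HasSymmetricRoots K) : IsWeaklyBalanced K := by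
  have hneg : ∀ z ∈ spectrum ℂ K, -z ∈ spectrum ℂ K := by
    intro z hz
    by_cases h0 : z = 0
    · rwa [h0, neg_zero, ← h0]
    have h1 := ((hK.hasEigenvalue_iff_mem_spectrum h0).2 hz)
    obtain ⟨v, hv⟩ := h1.exists_hasEigenvector
    have h2 : Module.rank ℂ (rootSpace K (-z)) ≠ 0 := by
      rw [← h z, Ne, rank_zero_iff, not_subsingleton_iff_nontrivial]
      refine ⟨⟨v, mem_rootSpace.2 ⟨1, ?_⟩⟩, 0, fun hv0 => hv.2 (congrArg Subtype.val hv0)⟩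
      have := hv.apply_eq_smul
      simpa [sub_eq_zero] using this
    rw [Ne, rank_zero_iff, not_subsingleton_iff_nontrivial] at h2
    obtain ⟨w, hw⟩ := exists_ne (0 : rootSpace K (-z))
    exact mem_spectrum_of_mem_rootSpace w.2 fun hw0 => hw (Subtype.ext hw0)
  refine ⟨?_, ?_⟩
  · rw [← spectrum.neg_eq]
    ext z
    rw [Set.mem_neg]
    exact ⟨hneg z, fun hz => by simpa using hneg _ hz⟩
  · rintro Ω₁ Ω₂ - - - - E F ⟨Γ, hΓ, rfl⟩ ⟨Δ, hΔ, rfl⟩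
    change hilbertDim (rangeOf (Γ.riesz K)) = hilbertDim (rangeOf (Δ.riesz K))
    by_cases hΩ : FiniteDimensional ℂ H ∨ (0 : ℂ) ∉ Ω₁
    · rw [hilbertDim, hilbertDim, hK.rangeOf_riesz hΓ hΩ, hK.rangeOf_riesz hΔ (by simpa using hΩ),
        rank_iSup_rootSpace, rank_iSup_rootSpace]
      refine congrArg Cardinal.toENat ?_
      let e : (-Ω₁ : Set ℂ) ≃ Ω₁ := (Equiv.neg ℂ).subtypeEquiv fun z => by simp
      exact (Cardinal.mk_sigma_congr e fun μ => by
        simp only [Cardinal.mk_out]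
        rw [h μ]
        rfl).symm
    · push Not at hΩ
      rw [hK.hilbertDim_rangeOf_riesz hΓ hΩ.1 hΩ.2,
        hK.hilbertDim_rangeOf_riesz hΔ hΩ.1 (by simpa using hΩ.2)]

end Compact

/-! ### Symmetry of multiplicities for limits of balanced operators and of commutators -/

section Necessity

variable {H : Type*} [NormedAddCommGroup H] [InnerProductSpace ℂ H] [CompleteSpace H]

theorem IsCompactOperator.eventually_isolated {K : H →L[ℂ] H} (hK : IsCompactOperator K)
    {w : ℂ} (hw : w ≠ 0) :
    ∀ᶠ r in 𝓝[>] (0 : ℝ), ∀ z ∈ spectrum ℂ K, z ∈ closedBall w r → z = w := by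
  have hpos := norm_pos_iff.2 hw
  have hf := (hK.finite_spectrum_norm_ge (half_pos hpos)).subset
    (sdiff_subset (s := {z ∈ spectrum ℂ K | ‖w‖ / 2 ≤ ‖z‖}) (t := {w}))
  obtain ⟨ε, hε, h⟩ := Metric.isOpen_iff.1 hf.isClosed.isOpen_compl w (by simp)
  have h1 : ∀ᶠ r in 𝓝[>] (0 : ℝ), r < min ε (‖w‖ / 2) :=
    (nhdsWithin_le_nhds) (gt_mem_nhds (lt_min hε (half_pos hpos)))
  filter_upwards [h1] with r hr z hz hzw
  by_contra hne
  refine h (closedBall_subset_ball (hr.trans_le (min_le_left _ _)) hzw) ⟨⟨hz, ?_⟩, hne⟩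
  have h2 : ‖w‖ - ‖z‖ ≤ ‖w‖ / 2 := calc
    ‖w‖ - ‖z‖ ≤ ‖w - z‖ := norm_sub_norm_le _ _
    _ ≤ r := by rw [mem_closedBall, dist_comm, dist_eq_norm] at hzw; exact hzw
    _ ≤ _ := (hr.trans_le (min_le_right _ _)).le
  linarith

omit [CompleteSpace H] in
theorem Contour.separates_circle {T : H →L[ℂ] H} {c : ℂ} {r : ℝ} (hr : 0 ≤ r)
    (h : Disjoint (sphere c r) (spectrum ℂ T)) : (circle c r).Separates T (ball c r) := by
  refine ⟨by rwa [trace_circle c hr], fun w hw => windingNumber_circle_of_mem hw.2,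
    fun w hw => windingNumber_circle_of_notMem hr fun hw' => ?_⟩
  exact disjoint_left.1 h (mem_sphere.2 (le_antisymm hw' (not_lt.1 hw.2))) hw.1

theorem isRieszIdempotent_circle {T : H →L[ℂ] H} {c : ℂ} {r : ℝ} (hr : 0 ≤ r)
    (h : Disjoint (sphere c r) (spectrum ℂ T)) :
    IsRieszIdempotent T (ball c r) ((Contour.circle c r).riesz T) :=
  ⟨_, Contour.separates_circle hr h, rfl⟩

/-- The closed disc of radius `r` about `c` misses `0` and meets the spectrum of `T` at most in
its centre. -/
structure IsIsolatingRadius (T : H →L[ℂ] H) (c : ℂ) (r : ℝ) : Prop where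
  pos : 0 < r
  lt_norm : r < ‖c‖
  eq_of_mem : ∀ z ∈ spectrum ℂ T, z ∈ closedBall c r → z = c

omit [CompleteSpace H] in
theorem IsIsolatingRadius.disjoint {T : H →L[ℂ] H} {c : ℂ} {r : ℝ} (h : IsIsolatingRadius T c r) :
    Disjoint (sphere c r) (spectrum ℂ T) := by
  refine disjoint_left.2 fun z hz hzT => ?_
  have := h.eq_of_mem z hzT (sphere_subset_closedBall hz)
  rw [this, mem_sphere, dist_self] at hz
  exact h.pos.ne hz

theorem IsCompactOperator.eventually_isIsolatingRadius {K : H →L[ℂ] H} (hK : IsCompactOperator K)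
    {w : ℂ} (hw : w ≠ 0) : ∀ᶠ r in 𝓝[>] (0 : ℝ), IsIsolatingRadius K w r := by
  filter_upwards [hK.eventually_isolated hw, self_mem_nhdsWithin,
    nhdsWithin_le_nhds (gt_mem_nhds (norm_pos_iff.2 hw))] with r h1 h2 h3
  exact ⟨h2, h3, h1⟩

theorem IsCompactOperator.rangeOf_riesz_circle {K : H →L[ℂ] H} (hK : IsCompactOperator K)
    {c : ℂ} {r : ℝ} (hr : 0 ≤ r) (hrc : r ≤ ‖c‖) (h : Disjoint (sphere c r) (spectrum ℂ K)) :
    rangeOf ((Contour.circle c r).riesz K) = ⨆ μ : ball c r, rootSpace K μ :=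
  hK.rangeOf_riesz (Contour.separates_circle hr h) (Or.inr (by simpa using hrc))

theorem IsIsolatingRadius.rangeOf_riesz_circle {K : H →L[ℂ] H} {c : ℂ} {r : ℝ}
    (h : IsIsolatingRadius K c r) (hK : IsCompactOperator K) :
    rangeOf ((Contour.circle c r).riesz K) = rootSpace K c := by
  rw [hK.rangeOf_riesz_circle h.pos.le h.lt_norm.le h.disjoint]
  refine le_antisymm (iSup_le fun μ x hx => ?_)
    (le_iSup (fun μ : ball c r => rootSpace K μ) ⟨c, mem_ball_self h.pos⟩)
  by_cases h0 : x = 0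
  · rw [h0]; exact zero_mem _
  · rwa [← h.eq_of_mem μ (mem_spectrum_of_mem_rootSpace hx h0) (ball_subset_closedBall μ.2)]

theorem IsIsolatingRadius.eventually_rank_eq {K : H →L[ℂ] H} {c : ℂ} {r : ℝ}
    (h : IsIsolatingRadius K c r) (hK : IsCompactOperator K) :
    ∀ᶠ T in 𝓝 K, Disjoint (sphere c r) (spectrum ℂ T) ∧
      Module.rank ℂ (rangeOf ((Contour.circle c r).riesz T)) = Module.rank ℂ (rootSpace K c) := by
  rw [← h.rangeOf_riesz_circle hK]
  exact eventually_rank_riesz_circle_eq h.pos h.disjoint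

/-- For `T` close to `K`, the ranks over small circles about `c` and `-c` are the multiplicities of
`K` there, hence finite. An inequality suffices, as it can be applied at `-c` too. -/
theorem hasSymmetricRoots_of_mem_closure {K : H →L[ℂ] H} (hK : IsCompactOperator K)
    {S : Set (H →L[ℂ] H)} (hKS : K ∈ closure S)
    (hS : ∀ T ∈ S, ∀ (c : ℂ) (r : ℝ), 0 < r → r < ‖c‖ → Disjoint (sphere c r) (spectrum ℂ T) →
      Disjoint (sphere (-c) r) (spectrum ℂ T) →
      FiniteDimensional ℂ (rangeOf ((Contour.circle c r).riesz T)) →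
      FiniteDimensional ℂ (rangeOf ((Contour.circle (-c) r).riesz T)) →
      Module.rank ℂ (rangeOf ((Contour.circle c r).riesz T)) ≤
        Module.rank ℂ (rangeOf ((Contour.circle (-c) r).riesz T))) :
    HasSymmetricRoots K := by
  have key : ∀ c : ℂ, c ≠ 0 →
      Module.rank ℂ (rootSpace K c) ≤ Module.rank ℂ (rootSpace K (-c)) := by
    intro c hc
    have hc' := neg_ne_zero.2 hc
    obtain ⟨r, hr, hr'⟩ := ((hK.eventually_isIsolatingRadius hc).and
      (hK.eventually_isIsolatingRadius hc')).exists
    obtain ⟨T, hTS, ⟨h1, h2⟩, h3, h4⟩ := ((mem_closure_iff_frequently.1 hKS).and_eventually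
      ((hr.eventually_rank_eq hK).and (hr'.eventually_rank_eq hK))).exists
    have := hK.finiteDimensional_rootSpace hc
    have := hK.finiteDimensional_rootSpace hc'
    rw [← h2, ← h4]
    refine hS T hTS c r hr.pos hr.lt_norm h1 h3 ?_ ?_
    · exact Module.rank_lt_aleph0_iff.1 (h2 ▸ Module.rank_lt_aleph0 ℂ _)
    · exact Module.rank_lt_aleph0_iff.1 (h4 ▸ Module.rank_lt_aleph0 ℂ _)
  intro μ
  by_cases h0 : μ = 0
  · rw [h0, neg_zero]
  · refine le_antisymm (key μ h0) ?_
    have := key (-μ) (neg_ne_zero.2 h0)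
    rwa [neg_neg] at this

theorem hasSymmetricRoots_of_mem_closure_wBal {K : H →L[ℂ] H} (hK : IsCompactOperator K)
    (h : K ∈ closure (WBal H)) : HasSymmetricRoots K := by
  refine hasSymmetricRoots_of_mem_closure hK h fun T hT c r hr hrc h1 h2 h3 h4 => ?_
  have h5 := hT.dim_eq (ball c r) (closedBall c r)ᶜ isOpen_ball isClosed_closedBall.isOpen_compl
    (disjoint_compl_right.mono_left ball_subset_closedBall) (fun z hz => by
      by_cases hz' : z ∈ closedBall c r
      · refine Or.inl (lt_of_le_of_ne hz' fun he => disjoint_left.1 h1 he hz)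
      · exact Or.inr hz') _ _ (isRieszIdempotent_circle hr.le h1)
    (by rw [neg_ball]; exact isRieszIdempotent_circle hr.le h2)
  -- `hilbertDim` forgets the size of infinite ranks, so finiteness is what recovers equality of
  -- cardinals.
  exact (Cardinal.toENat_injOn (Module.rank_lt_aleph0 ℂ _).le (Module.rank_lt_aleph0 ℂ _).le h5).le

theorem finrank_riesz_le_of_commutator {A B T : H →L[ℂ] H} (hA : A ^ 2 = 0) (hB : B ^ 2 = 0)
    (hT : T = A * B - B * A) {c : ℂ} {r : ℝ} (hr : 0 < r) (hrc : r < ‖c‖)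
    (h1 : Disjoint (sphere c r) (spectrum ℂ T)) (h2 : Disjoint (sphere (-c) r) (spectrum ℂ T))
    [FiniteDimensional ℂ (rangeOf ((Contour.circle c r).riesz T))]
    [FiniteDimensional ℂ (rangeOf ((Contour.circle (-c) r).riesz T))] :
    Module.finrank ℂ (rangeOf ((Contour.circle c r).riesz T)) ≤
      Module.finrank ℂ (rangeOf ((Contour.circle (-c) r).riesz T)) := by
  set E := (Contour.circle c r).riesz T with hE
  set F := (Contour.circle (-c) r).riesz T with hF
  rw [pow_two] at hA hB
  have hAT : A * T = -(T * A) := by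
    rw [hT, mul_sub, sub_mul, ← mul_assoc, hA, mul_assoc B, hA]; simp [mul_assoc]
  have hBT : B * T = -(T * B) := by
    rw [hT, mul_sub, sub_mul, ← mul_assoc B B, hB, mul_assoc A, hB]; simp [mul_assoc]
  have hAE : A * E = F * A := mul_riesz_circle_of_anticommute hAT hr.le h1 h2
  have hBE : B * E = F * B := mul_riesz_circle_of_anticommute hBT hr.le h1 h2
  have hEi : IsIdempotentElem E := Contour.isIdempotentElem_riesz_circle hr h1
  have hinto : ∀ C : H →L[ℂ] H, C * E = F * C → ∀ x ∈ rangeOf E, C x ∈ rangeOf F := by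
    rintro C hC _ ⟨x, rfl⟩
    exact ⟨C x, (DFunLike.congr_fun hC x).symm⟩
  -- A vector killed by `T` is a root vector at `0`, which lies outside the circle, so `E` kills it.
  have hinj : Function.Injective ((T : H →ₗ[ℂ] H).domRestrict (rangeOf E)) := by
    rw [injective_iff_map_eq_zero]
    rintro ⟨x, hx⟩ hTx
    have h3 : T x = 0 := hTx
    have h4 : (0 : ℂ) ∉ closedBall c r := by simpa using hrc
    have h5 := (Contour.circle c r).riesz_apply_of_mem_rootSpace (μ := 0)
      (by rwa [Contour.trace_circle _ hr.le])
      (by rw [Contour.trace_circle _ hr.le]; exact fun h => h4 (sphere_subset_closedBall h))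
      (mem_rootSpace.2 ⟨1, by simpa using h3⟩)
    rw [Contour.windingNumber_circle_of_notMem hr.le h4, zero_smul, ← hE,
      hEi.apply_of_mem_rangeOf hx] at h5
    simpa using h5
  let N : Submodule ℂ (rangeOf F) := LinearMap.ker ((A : H →ₗ[ℂ] H).domRestrict (rangeOf F))
  have hle : LinearMap.range ((T : H →ₗ[ℂ] H).domRestrict (rangeOf E)) ≤
      LinearMap.range ((A : H →ₗ[ℂ] H).domRestrict (rangeOf F)) ⊔
        (N.map (rangeOf F).subtype).map (B : H →ₗ[ℂ] H) := by
    rintro _ ⟨⟨x, hx⟩, rfl⟩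
    -- `T x = A (B x) + B (-A x)`, where `B x` and `-A x` lie in `ran F`, and `A² = 0` puts `-A x`
    -- in the kernel of `A`.
    refine Submodule.mem_sup.2 ⟨A (B x), ⟨⟨B x, hinto B hBE x hx⟩, rfl⟩, B (-A x), ?_, ?_⟩
    · refine Submodule.mem_map_of_mem ⟨⟨-A x, neg_mem (hinto A hAE x hx)⟩, ?_, rfl⟩
      show A (-A x) = 0
      rw [map_neg, neg_eq_zero]
      exact DFunLike.congr_fun hA x
    · simp [hT, sub_eq_add_neg]
  calc Module.finrank ℂ (rangeOf E)
      = Module.finrank ℂ (LinearMap.range ((T : H →ₗ[ℂ] H).domRestrict (rangeOf E))) :=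
        (LinearMap.finrank_range_of_inj hinj).symm
    _ ≤ _ := Submodule.finrank_mono hle
    _ ≤ Module.finrank ℂ (LinearMap.range ((A : H →ₗ[ℂ] H).domRestrict (rangeOf F))) +
        Module.finrank ℂ ((N.map (rangeOf F).subtype).map (B : H →ₗ[ℂ] H)) :=
        Submodule.finrank_add_le_finrank_add_finrank _ _
    _ ≤ Module.finrank ℂ (LinearMap.range ((A : H →ₗ[ℂ] H).domRestrict (rangeOf F))) +
        Module.finrank ℂ N := by
        gcongr
        exact (Submodule.finrank_map_le _ _).trans (Submodule.finrank_map_le _ _)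
    _ = _ := LinearMap.finrank_range_add_finrank_ker _

theorem hasSymmetricRoots_of_mem_closure_commutatorsOf {K : H →L[ℂ] H} (hK : IsCompactOperator K)
    (h : K ∈ closure (commutatorsOf (nilTwo H))) : HasSymmetricRoots K := by
  refine hasSymmetricRoots_of_mem_closure hK h fun T hT c r hr hrc h1 h2 h3 h4 => ?_
  obtain ⟨A, hA, B, hB, hT⟩ := hT
  rw [← Module.finrank_eq_rank, ← Module.finrank_eq_rank, Nat.cast_le]
  exact finrank_riesz_le_of_commutator hA hB hT hr hrc h1 h2

end Necessity

/-! ### Index zero for nonzero translates of compact operators -/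

section Index

variable {H : Type*} [NormedAddCommGroup H] [InnerProductSpace ℂ H] [CompleteSpace H]

omit [CompleteSpace H] in
-- `V` is spanned by a finite `ε`-net of the image of the unit ball. Allowing every larger `W` lets
-- `K` and its adjoint share one subspace later.
theorem IsCompactOperator.exists_norm_sub_starProjection_mul_le {K : H →L[ℂ] H}
    (hK : IsCompactOperator K) {ε : ℝ} (hε : 0 < ε) :
    ∃ V : Submodule ℂ H, FiniteDimensional ℂ V ∧ ∀ (W : Submodule ℂ H) [FiniteDimensional ℂ W],
      V ≤ W → ‖K - W.starProjection * K‖ ≤ ε := by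
  obtain ⟨C, hC, hKC⟩ := hK.image_closedBall_subset_compact (f := (K : H →ₗ[ℂ] H)) 1
  obtain ⟨t, ht, hCt⟩ := Metric.totallyBounded_iff.1 hC.totallyBounded ε hε
  refine ⟨Submodule.span ℂ t, FiniteDimensional.span_of_finite ℂ ht, fun W _ hW => ?_⟩
  refine ContinuousLinearMap.opNorm_le_of_unit_norm hε.le fun x hx => ?_
  obtain ⟨y, hy, hxy⟩ := mem_iUnion₂.1 (hCt (hKC (mem_image_of_mem _
    (show x ∈ closedBall (0 : H) 1 by simp [hx]))))
  rw [mem_ball, dist_eq_norm] at hxy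
  have hyW : y ∈ W := hW (Submodule.subset_span hy)
  show ‖K x - W.starProjection (K x)‖ ≤ ε
  rw [W.starProjection_minimal]
  refine (ciInf_le ⟨0, ?_⟩ (⟨y, hyW⟩ : W)).trans hxy.le
  rintro _ ⟨z, rfl⟩
  exact norm_nonneg _

omit [CompleteSpace H] in
theorem isCompactOperator_mul_starProjection (T : H →L[ℂ] H) (V : Submodule ℂ H)
    [FiniteDimensional ℂ V] : IsCompactOperator (T * V.starProjection : H →L[ℂ] H) := by
  have h : IsCompactOperator (V.orthogonalProjectionOnto : H →L[ℂ] V) :=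
    isCompactOperator_of_locallyCompactSpace_dom _
  exact h.clm_comp (T.comp V.subtypeL)

/-- Schauder's theorem by approximation: `K* - K* P` is the adjoint of `K - P K`, hence small, and
`K* P` has finite rank. -/
theorem IsCompactOperator.adjoint {K : H →L[ℂ] H} (hK : IsCompactOperator K) :
    IsCompactOperator (ContinuousLinearMap.adjoint K) := by
  have h : ContinuousLinearMap.adjoint K ∈ closure {T : H →L[ℂ] H | IsCompactOperator T} := by
    refine Metric.mem_closure_iff.2 fun ε hε => ?_
    obtain ⟨V, hV, h⟩ := hK.exists_norm_sub_starProjection_mul_le (half_pos hε)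
    refine ⟨_, isCompactOperator_mul_starProjection (ContinuousLinearMap.adjoint K) V, ?_⟩
    have h1 : ContinuousLinearMap.adjoint K - ContinuousLinearMap.adjoint K * V.starProjection =
        star (K - V.starProjection * K) := by
      rw [star_sub, star_mul, ContinuousLinearMap.star_eq_adjoint,
        (isSelfAdjoint_starProjection V).star_eq]
    rw [dist_eq_norm, h1, norm_star]
    linarith [h V le_rfl]
  rwa [isClosed_setOfPred_isCompactOperator.closure_eq] at h

/-- With `T = K - α`, suppose `ker T*` is larger. An injection `L` of `ker T` into `ker T* = (ran
T)ᗮ` cannot be onto. Put `G = L P` with `P` the projection onto `ker T`. As `ran T ⊥ ran G`, the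
operator `T + G` is injective, so onto by the Fredholm alternative for `K + G`. Solving `T x + G x =
y` for `y ∈ ker T*` forces `G x = y`, so `L` is onto after all. -/
theorem IsCompactOperator.rank_ker_adjoint_le {K : H →L[ℂ] H} (hK : IsCompactOperator K)
    {α : ℂ} (hα : α ≠ 0) :
    Module.rank ℂ (LinearMap.ker
        (ContinuousLinearMap.adjoint (K - α • (1 : H →L[ℂ] H)) : H →ₗ[ℂ] H)) ≤
      Module.rank ℂ (LinearMap.ker ((K - α • (1 : H →L[ℂ] H) : H →L[ℂ] H) : H →ₗ[ℂ] H)) := by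
  set T := K - α • (1 : H →L[ℂ] H) with hT
  set N := LinearMap.ker (T : H →ₗ[ℂ] H) with hN
  set R := LinearMap.ker (ContinuousLinearMap.adjoint T : H →ₗ[ℂ] H) with hR
  have hRorth : R = (LinearMap.range (T : H →ₗ[ℂ] H))ᗮ := (ContinuousLinearMap.orthogonal_range T).symm
  have := hK.finiteDimensional_rootSpace hα
  have hNfin : FiniteDimensional ℂ N := by
    refine Submodule.finiteDimensional_of_le (S₂ := rootSpace K α) fun x hx => ?_
    exact mem_rootSpace.2 ⟨1, by rw [pow_one]; exact hx⟩
  by_contra! hlt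
  obtain ⟨L, hL⟩ := Module.Free.exists_linearMap_injective_of_rank_lt hlt
  have hLsurj : ¬ Function.Surjective L := fun hs =>
    hlt.ne (LinearEquiv.ofBijective L ⟨hL, hs⟩).rank_eq
  let G : H →L[ℂ] H := (R.subtypeL.comp (LinearMap.toContinuousLinearMap L)).comp
    N.orthogonalProjectionOnto
  have hG : IsCompactOperator G := by
    have h : IsCompactOperator (N.orthogonalProjectionOnto : H →L[ℂ] N) :=
      isCompactOperator_of_locallyCompactSpace_dom _
    exact h.clm_comp (R.subtypeL.comp (LinearMap.toContinuousLinearMap L))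
  have hGR : ∀ x, G x ∈ R := fun x => (L _).2
  have hdisj : ∀ x y, T x = y → y ∈ R → y = 0 := fun x y hxy hy => by
    rw [hRorth] at hy
    exact inner_self_eq_zero.1 (hy y ⟨x, hxy⟩)
  have hKG : IsCompactOperator (K + G : H →L[ℂ] H) := hK.add hG
  have hval : ∀ x, (K + G) x - α • x = T x + G x := fun x => by simp [hT]; abel
  have hres : α ∈ resolventSet ℂ (K + G) := by
    refine (hKG.hasEigenvalue_or_mem_resolventSet hα).resolve_left fun hev => ?_
    obtain ⟨x, hx⟩ := hev.exists_hasEigenvector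
    have h1 : T x + G x = 0 := by
      rw [← hval, sub_eq_zero]
      exact hx.apply_eq_smul
    have h2 : G x = 0 := by
      have := hdisj (-x) (G x) (by rw [map_neg]; exact neg_eq_of_add_eq_zero_right h1) (hGR x)
      exact this
    rw [h2, add_zero] at h1
    have h3 : L ⟨x, h1⟩ = 0 := by
      have h4 : N.orthogonalProjectionOnto x = ⟨x, h1⟩ :=
        N.orthogonalProjectionOnto_mem_subspace_eq_self ⟨x, h1⟩
      have : L (N.orthogonalProjectionOnto x) = 0 := Subtype.ext h2
      rwa [h4] at this
    exact hx.2 (congrArg Subtype.val ((map_eq_zero_iff L hL).1 h3))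
  apply hLsurj
  intro y
  obtain ⟨U, hU⟩ := (spectrum.mem_resolventSet_iff.1 hres)
  set x : H := (↑U⁻¹ : H →L[ℂ] H) (-(y : H)) with hx
  have h1 : T x + G x = y := by
    rw [← hval]
    have h2 : (U : H →L[ℂ] H) x = -(y : H) := by
      rw [hx, ← mul_apply_eq_comp, Units.mul_inv]; rfl
    rw [hU] at h2
    have h3 : (algebraMap ℂ (H →L[ℂ] H) α - (K + G)) x = α • x - (K + G) x := by
      simp [Algebra.algebraMap_eq_smul_one]
    rw [h3] at h2
    rw [← neg_sub, h2, neg_neg]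
  have h2 : (y : H) - G x = 0 := hdisj x _ (by rw [← h1]; abel) (sub_mem y.2 (hGR x))
  exact ⟨N.orthogonalProjectionOnto x, Subtype.ext (sub_eq_zero.1 h2).symm⟩

theorem IsCompactOperator.fredholmIndex_sub_smul {K : H →L[ℂ] H} (hK : IsCompactOperator K)
    {α : ℂ} (hα : α ≠ 0) : fredholmIndex (K - α • (1 : H →L[ℂ] H)) = 0 := by
  have h1 := hK.rank_ker_adjoint_le hα
  have hadj : ContinuousLinearMap.adjoint (K - α • (1 : H →L[ℂ] H)) =
      ContinuousLinearMap.adjoint K - star α • (1 : H →L[ℂ] H) := by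
    rw [← ContinuousLinearMap.star_eq_adjoint, star_sub, star_smul, star_one,
      ContinuousLinearMap.star_eq_adjoint]
  have h2 := hK.adjoint.rank_ker_adjoint_le (star_ne_zero.2 hα)
  rw [← hadj, ContinuousLinearMap.adjoint_adjoint] at h2
  have := hK.finiteDimensional_rootSpace hα
  have hfin : FiniteDimensional ℂ
      (LinearMap.ker ((K - α • (1 : H →L[ℂ] H) : H →L[ℂ] H) : H →ₗ[ℂ] H)) := by
    refine Submodule.finiteDimensional_of_le (S₂ := rootSpace K α) fun x hx => ?_
    exact mem_rootSpace.2 ⟨1, by simpa using hx⟩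
  rw [fredholmIndex, nullity, nullity, hilbertDim, hilbertDim, le_antisymm h1 h2]
  have hlt := Cardinal.toENat_lt_top.2 (Module.rank_lt_aleph0 ℂ
    (LinearMap.ker ((K - α • (1 : H →L[ℂ] H) : H →L[ℂ] H) : H →ₗ[ℂ] H)))
  obtain ⟨n, hn⟩ := ENat.ne_top_iff_exists.1 hlt.ne
  rw [← hn]
  -- The common nullity is finite, which excludes `∞ - ∞`.
  apply EReal.sub_self <;> simp

omit [CompleteSpace H] in
theorem IsCompactOperator.isSemiFredholm_sub_smul {K : H →L[ℂ] H} (hK : IsCompactOperator K)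
    {α : ℂ} (hα : α ≠ 0) : IsSemiFredholm (K - α • (1 : H →L[ℂ] H)) := by
  have h0 : calkinMap H K = 0 := by
    have h : (compactIdeal H).ringCon K 0 := by
      rw [← TwoSidedIdeal.mem_iff]
      exact (TwoSidedIdeal.mem_mk' ..).2 hK
    exact (RingCon.eq _).2 h
  refine Or.inl ⟨calkinMap H (-α⁻¹ • 1), ?_⟩
  rw [map_sub, h0, zero_sub, mul_neg, ← map_mul, ← map_neg, smul_mul_smul_comm]
  simp [hα]

theorem HasSymmetricRoots.isBalanced {K : H →L[ℂ] H} (hK : IsCompactOperator K)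
    (h : HasSymmetricRoots K) : IsBalanced K := by
  have hneg : ∀ α : ℂ, K + α • (1 : H →L[ℂ] H) = K - (-α) • (1 : H →L[ℂ] H) := fun α => by
    rw [neg_smul, sub_neg_eq_add]
  refine ⟨h.isWeaklyBalanced hK, fun α => ?_, fun α _ => ?_⟩
  · by_cases h0 : α = 0
    · simp [h0]
    · rw [hneg]
      exact iff_of_true (hK.isSemiFredholm_sub_smul h0)
        (hK.isSemiFredholm_sub_smul (neg_ne_zero.2 h0))
  · by_cases h0 : α = 0
    · simp [h0]
    · rw [hneg, hK.fredholmIndex_sub_smul h0, hK.fredholmIndex_sub_smul (neg_ne_zero.2 h0)]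

end Index

/-! ### Separating a symmetric family of numbers into distinct ones -/

section HalfPlane

/-- A half-plane of complex numbers containing exactly one of `z`, `-z` for every `z ≠ 0`. -/
def InHalfPlane (z : ℂ) : Prop := 0 < z.re ∨ z.re = 0 ∧ 0 < z.im

theorem InHalfPlane.not_neg {z : ℂ} (h : InHalfPlane z) : ¬ InHalfPlane (-z) := by
  unfold InHalfPlane at *
  simp only [Complex.neg_re, Complex.neg_im]
  rintro (h' | ⟨h', h''⟩) <;> rcases h with h | ⟨h, h2⟩ <;> linarith

theorem inHalfPlane_or_neg {z : ℂ} (h1 : ¬ InHalfPlane z) (h2 : ¬ InHalfPlane (-z)) : z = 0 := by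
  unfold InHalfPlane at *
  simp only [Complex.neg_re, Complex.neg_im] at *
  push Not at h1 h2
  have hre : z.re = 0 := by linarith [h1.1, h2.1]
  exact Complex.ext hre (by
    have := h1.2 hre
    have := h2.2 (by linarith)
    simp only [Complex.zero_im]
    linarith)

end HalfPlane

section Combinatorics

theorem exists_injective_offset {ι : Type*} [Finite ι] (c : ι → ℂ)
    (h : ∀ μ, Nat.card {i // c i = μ} = Nat.card {i // c i = -μ}) :
    ∃ f : ι → ℝ, (∀ i j, c i = c j → f i = f j → i = j) ∧
      ∀ i, ∃ j, c j = -c i ∧ f j = -f i := by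
  classical
  let φ : ∀ μ, {i // c i = μ} ≃ Fin (Nat.card {i // c i = μ}) := fun μ => Finite.equivFin _
  let m : ℂ → ℕ := fun μ => Nat.card {i // c i = μ}
  let k : ι → ℕ := fun i => (φ (c i) ⟨i, rfl⟩).val
  have hk : ∀ i, k i < m (c i) := fun i => (φ (c i) ⟨i, rfl⟩).isLt
  have hkφ : ∀ μ (i : {i // c i = μ}), k i = φ μ i := by
    rintro _ ⟨i, rfl⟩
    rfl
  have hkinj : ∀ i j, c i = c j → k i = k j → i = j := by
    intro i j hc hkij
    have h1 := hkφ (c j) ⟨i, hc⟩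
    have h2 := hkφ (c j) ⟨j, rfl⟩
    have h3 : φ (c j) ⟨i, hc⟩ = φ (c j) ⟨j, rfl⟩ := Fin.ext (by rw [← h1, ← h2]; exact hkij)
    exact congrArg Subtype.val ((φ (c j)).injective h3)
  have hksurj : ∀ μ, ∀ l < m μ, ∃ i, c i = μ ∧ k i = l := fun μ l hl => by
    refine ⟨(φ μ).symm ⟨l, hl⟩, ((φ μ).symm ⟨l, hl⟩).2, ?_⟩
    rw [hkφ μ, Equiv.apply_symm_apply]
  -- The fibres over `μ` and `-μ` get opposite offsets. The last case is `μ = 0`, where the offsets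
  -- are `2`-spaced and centred at `0`, so that `l ↦ m - 1 - l` negates them.
  let g : ℂ → ℕ → ℝ := fun μ l =>
    if InHalfPlane μ then l + 1 else if InHalfPlane (-μ) then -(l + 1) else 2 * l + 1 - m μ
  have hginj : ∀ μ l l', g μ l = g μ l' → l = l' := by
    intro μ l l' hl
    have : (l : ℝ) = l' := by
      simp only [g] at hl
      split_ifs at hl <;> linarith
    exact_mod_cast this
  refine ⟨fun i => g (c i) (k i), fun i j hc hf => hkinj i j hc ?_, fun i => ?_⟩
  · simp only [hc] at hf
    exact hginj _ _ _ hf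
  · have hki := hk i
    have hm : m (-c i) = m (c i) := (h (c i)).symm
    by_cases h1 : InHalfPlane (c i)
    · obtain ⟨j, hj, hkj⟩ := hksurj (-c i) (k i) (hm ▸ hki)
      exact ⟨j, hj, by simp [g, hj, hkj, h1, h1.not_neg]⟩
    by_cases h2 : InHalfPlane (-c i)
    · obtain ⟨j, hj, hkj⟩ := hksurj (-c i) (k i) (hm ▸ hki)
      exact ⟨j, hj, by simp only [g, hj, hkj, h1, h2, if_true, if_false]; ring⟩
    · obtain ⟨j, hj, hkj⟩ := hksurj (-c i) (m (c i) - 1 - k i) (by omega)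
      refine ⟨j, hj, ?_⟩
      have h3 : ((m (c i) - 1 - k i : ℕ) : ℝ) = m (c i) - 1 - k i := by
        rw [Nat.sub_sub, Nat.cast_sub (by omega)]; push_cast; ring
      simp only [g, hj, hkj, neg_neg, h1, h2, if_false, h3, hm]
      ring

/-- Move along `c + t f` with `t > 0` small: equal values of `c` are separated by `f`, distinct ones
stay distinct, and the symmetry persists for every `t`. -/
theorem exists_injective_perturbation {ι : Type*} [Finite ι] (c : ι → ℂ)
    (h : ∀ μ, Nat.card {i // c i = μ} = Nat.card {i // c i = -μ}) {ε : ℝ} (hε : 0 < ε) :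
    ∃ e : ι → ℂ, Function.Injective e ∧ (∀ i, ‖e i - c i‖ < ε) ∧ ∀ i, ∃ j, e j = -e i := by
  obtain ⟨f, hf, hneg⟩ := exists_injective_offset c h
  have hcont : ∀ i, Continuous fun t : ℝ => c i + (t : ℂ) * f i := fun i => by fun_prop
  have h1 : ∀ᶠ t : ℝ in 𝓝[>] (0 : ℝ), ∀ i j, i ≠ j → c i + (t : ℂ) * f i ≠ c j + (t : ℂ) * f j := by
    simp only [Filter.eventually_all]
    intro i j hij
    by_cases hc : c i = c j
    · filter_upwards [self_mem_nhdsWithin] with t ht heq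
      rw [hc, add_right_inj] at heq
      have := mul_left_cancel₀ (Complex.ofReal_ne_zero.2 (ne_of_gt ht)) heq
      exact hij (hf i j hc (by exact_mod_cast this))
    · refine nhdsWithin_le_nhds ?_
      exact (((hcont i).sub (hcont j)).continuousAt.eventually_ne (x := (0 : ℝ)) (y := 0)
        (by simpa [sub_eq_zero] using hc)).mono fun t ht => sub_ne_zero.1 ht
  have h2 : ∀ᶠ t : ℝ in 𝓝[>] (0 : ℝ), ∀ i, ‖c i + (t : ℂ) * f i - c i‖ < ε := by
    simp only [Filter.eventually_all]
    intro i
    refine nhdsWithin_le_nhds ?_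
    have : Continuous fun t : ℝ => ‖c i + (t : ℂ) * f i - c i‖ := by fun_prop
    exact (this.tendsto 0).eventually (gt_mem_nhds (by simpa using hε))
  obtain ⟨t, ht1, ht2⟩ := (h1.and h2).exists
  refine ⟨fun i => c i + (t : ℂ) * f i, fun i j hij => ?_, ht2, fun i => ?_⟩
  · by_contra hne
    exact ht1 i j hne hij
  · obtain ⟨j, hj1, hj2⟩ := hneg i
    exact ⟨j, by simp only [hj1, hj2]; push_cast; ring⟩

end Combinatorics

/-! ### Triangular operators and commutators in finite dimension -/

section FiniteDimensional

variable {V : Type*} [NormedAddCommGroup V] [InnerProductSpace ℂ V]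

/-- On the pair of eigenvectors for `e` and `-e`, with `e` in the half-plane, `B` maps the first to
`e` times the second and `A` maps the second back to the first. Each moves only one half-plane into
the other, so both square to zero. On a zero eigenvalue both vanish. -/
theorem exists_commutator_of_eigenbasis {ι : Type*} (v : Module.Basis ι ℂ V) (T : V →ₗ[ℂ] V)
    (e : ι → ℂ) (he : Function.Injective e) (hneg : ∀ i, ∃ j, e j = -e i)
    (hT : ∀ i, T (v i) = e i • v i) :
    ∃ A B : V →ₗ[ℂ] V, A * A = 0 ∧ B * B = 0 ∧ T = A * B - B * A := by
  classical
  choose s hs using hneg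
  have hss : ∀ i, s (s i) = i := fun i => he (by rw [hs, hs, neg_neg])
  let A : V →ₗ[ℂ] V := v.constr ℂ fun i => if InHalfPlane (-e i) then v (s i) else 0
  let B : V →ₗ[ℂ] V := v.constr ℂ fun i => if InHalfPlane (e i) then e i • v (s i) else 0
  have hA : ∀ i, A (v i) = if InHalfPlane (-e i) then v (s i) else 0 := v.constr_basis ℂ _
  have hB : ∀ i, B (v i) = if InHalfPlane (e i) then e i • v (s i) else 0 := v.constr_basis ℂ _
  refine ⟨A, B, v.ext fun i => ?_, v.ext fun i => ?_, v.ext fun i => ?_⟩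
  · rw [Module.End.mul_apply, hA]
    split_ifs with h
    · rw [hA, hs, neg_neg, if_neg fun h' => h'.not_neg h]; rfl
    · simp
  · rw [Module.End.mul_apply, hB]
    split_ifs with h
    · rw [map_smul, hB, hs, if_neg h.not_neg]; simp
    · simp
  · rw [LinearMap.sub_apply, Module.End.mul_apply, Module.End.mul_apply, hA, hB, hT]
    by_cases h1 : InHalfPlane (e i)
    · rw [if_pos h1, if_neg h1.not_neg, map_smul, hA, hs, neg_neg, if_pos h1, hss]
      simp
    by_cases h2 : InHalfPlane (-e i)
    · rw [if_neg h1, if_pos h2, hB, hs, if_pos h2, hss]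
      simp
    · rw [if_neg h1, if_neg h2, inHalfPlane_or_neg h1 h2]
      simp

variable [FiniteDimensional ℂ V]

/-- **Schur triangulation**. -/
theorem exists_orthonormalBasis_upperTriangular (n : ℕ) (hn : Module.finrank ℂ V = n)
    (T : V →ₗ[ℂ] V) :
    ∃ b : OrthonormalBasis (Fin n) ℂ V, ∀ i j, j < i → inner ℂ (b i) (T (b j)) = 0 := by
  induction n generalizing V with
  | zero =>
    exact ⟨(stdOrthonormalBasis ℂ V).reindex (finCongr hn), fun i => i.elim0⟩
  | succ n ih =>
    have : Nontrivial V := Module.nontrivial_of_finrank_pos (R := ℂ) (by omega)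
    -- The orthogonal complement of an eigenvector of the adjoint is invariant under `T`; the
    -- induction runs there and this vector comes last.
    obtain ⟨μ, hμ⟩ := Module.End.exists_eigenvalue (LinearMap.adjoint T)
    obtain ⟨w, hw⟩ := hμ.exists_hasEigenvector
    set v : V := (‖w‖⁻¹ : ℂ) • w with hv
    have hv1 : ‖v‖ = 1 := by
      rw [hv, norm_smul]; simp [hw.2]
    have hvT : LinearMap.adjoint T v = μ • v := by
      rw [hv, map_smul, hw.apply_eq_smul, smul_comm]
    set W : Submodule ℂ V := (ℂ ∙ v)ᗮ with hW
    have hWmem : ∀ x, x ∈ W ↔ inner ℂ v x = 0 := fun x => Submodule.mem_orthogonal_singleton_iff_inner_right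
    have hTW : ∀ x ∈ W, T x ∈ W := fun x hx => by
      rw [hWmem] at hx ⊢
      rw [← LinearMap.adjoint_inner_left, hvT, inner_smul_left, hx, mul_zero]
    have hv0 : v ≠ 0 := fun h => by simp [h] at hv1
    have hWn : Module.finrank ℂ W = n := by
      have : Fact (Module.finrank ℂ V = n + 1) := ⟨hn⟩
      exact Submodule.finrank_orthogonal_span_singleton hv0
    obtain ⟨b', hb'⟩ := ih hWn (T.restrict hTW)
    let u : Fin (n + 1) → V := Fin.snoc (fun i => (b' i : V)) v
    have hu1 : ∀ i : Fin n, u i.castSucc = b' i := fun i => by simp [u]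
    have hu2 : u (Fin.last n) = v := by simp [u]
    have hon : Orthonormal ℂ u := by
      rw [orthonormal_iff_ite]
      intro i j
      have hvb : ∀ k, inner ℂ v (b' k : V) = 0 := fun k => (hWmem _).1 (b' k).2
      induction i using Fin.lastCases with
      | last =>
        induction j using Fin.lastCases with
        | last => rw [hu2, inner_self_eq_norm_sq_to_K, hv1]; simp
        | cast j => rw [hu1, hu2, hvb, if_neg (Fin.castSucc_lt_last j).ne']
      | cast i =>
        induction j using Fin.lastCases with
        | last =>
          rw [hu1, hu2, ← inner_conj_symm, hvb, if_neg (Fin.castSucc_lt_last i).ne, map_zero]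
        | cast j =>
          have := (orthonormal_iff_ite.1 b'.orthonormal) i j
          rw [hu1, hu1, ← Submodule.coe_inner, this]
          simp
    have hcard : Fintype.card (Fin (n + 1)) = Module.finrank ℂ V := by simp [hn]
    let b := (basisOfOrthonormalOfCardEqFinrank hon hcard).toOrthonormalBasis (by simpa using hon)
    have hb : ∀ i, b i = u i := fun i => by simp [b]
    refine ⟨b, fun i j hij => ?_⟩
    rw [hb, hb]
    obtain ⟨j, rfl⟩ := Fin.exists_castSucc_eq.2 (hij.trans_le (Fin.le_last i)).ne
    rw [hu1]
    induction i using Fin.lastCases with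
    | last => rw [hu2]; exact (hWmem _).1 (hTW _ (b' j).2)
    | cast i =>
      rw [hu1]
      exact hb' i j (Fin.castSucc_lt_castSucc_iff.1 hij)

theorem charpoly_eq_prod_of_upperTriangular {n : ℕ} (b : OrthonormalBasis (Fin n) ℂ V)
    (T : V →ₗ[ℂ] V) (h : ∀ i j, j < i → inner ℂ (b i) (T (b j)) = 0) :
    T.charpoly = ∏ i, (Polynomial.X - Polynomial.C (inner ℂ (b i) (T (b i)))) := by
  have hM : ∀ i j, LinearMap.toMatrix b.toBasis b.toBasis T i j = inner ℂ (b i) (T (b j)) :=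
    fun i j => by simp [LinearMap.toMatrix_apply, OrthonormalBasis.repr_apply_apply]
  rw [← LinearMap.charpoly_toMatrix T b.toBasis, Matrix.charpoly_of_isUpperTriangular]
  · simp only [hM]
  · intro i j hij
    rw [hM]
    exact h i j hij

theorem rootMultiplicity_charpoly_of_upperTriangular {n : ℕ} (b : OrthonormalBasis (Fin n) ℂ V)
    (T : V →ₗ[ℂ] V) (h : ∀ i j, j < i → inner ℂ (b i) (T (b j)) = 0) (μ : ℂ) :
    T.charpoly.rootMultiplicity μ = Nat.card {i // inner ℂ (b i) (T (b i)) = μ} := by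
  classical
  set d : Fin n → ℂ := fun i => inner ℂ (b i) (T (b i)) with hd
  have hr : (∏ i, (Polynomial.X - Polynomial.C (d i))).roots =
      Multiset.map d Finset.univ.val := by
    rw [← Polynomial.roots_multiset_prod_X_sub_C (Multiset.map d Finset.univ.val),
      Multiset.map_map]
    rfl
  rw [charpoly_eq_prod_of_upperTriangular b T h, ← Polynomial.count_roots, hr,
    Multiset.count_map, Nat.card_eq_fintype_card, Fintype.card_subtype]
  simp only [eq_comm (a := μ)]
  rfl

/-- The operator that is diagonal with entries `w` in the orthonormal basis `b`. -/
def OrthonormalBasis.diagonal {n : ℕ} (b : OrthonormalBasis (Fin n) ℂ V) (w : Fin n → ℂ) :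
    V →ₗ[ℂ] V := b.toBasis.constr ℂ fun i => w i • b i

omit [FiniteDimensional ℂ V] in
theorem OrthonormalBasis.diagonal_apply_self {n : ℕ} (b : OrthonormalBasis (Fin n) ℂ V)
    (w : Fin n → ℂ) (i : Fin n) : b.diagonal w (b i) = w i • b i := by
  have := b.toBasis.constr_basis ℂ (fun i => w i • b i) i
  rwa [b.coe_toBasis] at this

omit [FiniteDimensional ℂ V] in
theorem OrthonormalBasis.norm_diagonal_apply_le {n : ℕ} (b : OrthonormalBasis (Fin n) ℂ V)
    {w : Fin n → ℂ} {ε : ℝ} (hε : 0 ≤ ε) (hw : ∀ i, ‖w i‖ ≤ ε) (x : V) :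
    ‖b.diagonal w x‖ ≤ ε * ‖x‖ := by
  have hx : ∀ i, inner ℂ (b i) (b.diagonal w x) = w i * inner ℂ (b i) x := fun i => by
    conv_lhs => rw [← b.sum_repr' x]
    simp only [map_sum, map_smul, b.diagonal_apply_self, inner_sum, inner_smul_right,
      orthonormal_iff_ite.1 b.orthonormal]
    simp [mul_comm]
  refine le_of_sq_le_sq ?_ (by positivity)
  rw [mul_pow, ← b.sum_sq_norm_inner_right, ← b.sum_sq_norm_inner_right x, Finset.mul_sum]
  refine Finset.sum_le_sum fun i _ => ?_
  rw [hx, norm_mul, mul_pow]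
  gcongr
  exact hw i

/-- Replacing the diagonal by `e` keeps the matrix triangular, so its eigenvalues are the distinct
`e i` and it has an eigenbasis. The change is diagonal in an orthonormal basis, so its norm is
controlled entrywise, however skew the eigenbasis is. -/
theorem exists_commutator_near_upperTriangular {n : ℕ} (b : OrthonormalBasis (Fin n) ℂ V)
    (T : V →ₗ[ℂ] V) (h : ∀ i j, j < i → inner ℂ (b i) (T (b j)) = 0) (e : Fin n → ℂ)
    (he : Function.Injective e) (hneg : ∀ i, ∃ j, e j = -e i) {ε : ℝ} (hε : 0 ≤ ε)
    (hclose : ∀ i, ‖e i - inner ℂ (b i) (T (b i))‖ ≤ ε) :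
    ∃ A B : V →ₗ[ℂ] V, A * A = 0 ∧ B * B = 0 ∧ ∀ x, ‖(A * B - B * A) x - T x‖ ≤ ε * ‖x‖ := by
  let w : Fin n → ℂ := fun i => e i - inner ℂ (b i) (T (b i))
  let S := T + b.diagonal w
  have hSb : ∀ i j, inner ℂ (b i) (S (b j)) = inner ℂ (b i) (T (b j)) + if i = j then w j else 0 := by
    intro i j
    rw [LinearMap.add_apply, inner_add_right, b.diagonal_apply_self, inner_smul_right,
      orthonormal_iff_ite.1 b.orthonormal]
    simp
  have hdiag : ∀ i, inner ℂ (b i) (S (b i)) = e i := fun i => by rw [hSb]; simp [w]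
  have hS : ∀ i j, j < i → inner ℂ (b i) (S (b j)) = 0 := fun i j hij => by
    rw [hSb, h i j hij, if_neg hij.ne', add_zero]
  have hev : ∀ i, Module.End.HasEigenvalue S (e i) := fun i => by
    rw [Module.End.hasEigenvalue_iff_isRoot_charpoly, charpoly_eq_prod_of_upperTriangular b S hS,
      Polynomial.IsRoot, Polynomial.eval_prod]
    exact Finset.prod_eq_zero (Finset.mem_univ i) (by simp [hdiag])
  choose v hv using fun i => (hev i).exists_hasEigenvector
  have hli := Module.End.eigenvectors_linearIndependent' S e he v hv
  have hcard : Fintype.card (Fin n) = Module.finrank ℂ V :=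
    (Module.finrank_eq_card_basis b.toBasis).symm
  cases n with
  | zero =>
    have hsub : ∀ x : V, x = 0 := fun x => by rw [← b.sum_repr' x]; simp
    exact ⟨0, 0, by simp, by simp, fun x => by simp [hsub x]⟩
  | succ n =>
    let vb := basisOfLinearIndependentOfCardEqFinrank hli hcard
    have hvb : ∀ i, vb i = v i := fun i => by simp [vb]
    obtain ⟨A, B, hA, hB, hAB⟩ := exists_commutator_of_eigenbasis vb S e he hneg
      fun i => by rw [hvb]; exact (hv i).apply_eq_smul
    refine ⟨A, B, hA, hB, fun x => ?_⟩
    rw [← hAB]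
    simpa [S] using b.norm_diagonal_apply_le hε hclose x

end FiniteDimensional

/-! ### Finite-dimensional compressions and extension by zero -/

section Sufficiency

variable {H : Type*} [NormedAddCommGroup H] [InnerProductSpace ℂ H] [CompleteSpace H]

theorem IsCompactOperator.exists_norm_sub_compression_lt {K : H →L[ℂ] H}
    (hK : IsCompactOperator K) {ε : ℝ} (hε : 0 < ε) :
    ∃ V : Submodule ℂ H, ∃ _ : FiniteDimensional ℂ V,
      ‖K - V.starProjection * K * V.starProjection‖ < ε := by
  obtain ⟨V₁, h1, hV₁⟩ := hK.exists_norm_sub_starProjection_mul_le (ε := ε / 3) (by positivity)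
  obtain ⟨V₂, h2, hV₂⟩ := hK.adjoint.exists_norm_sub_starProjection_mul_le (ε := ε / 3)
    (by positivity)
  refine ⟨V₁ ⊔ V₂, inferInstance, ?_⟩
  set P := (V₁ ⊔ V₂).starProjection with hP
  have e1 := hV₁ (V₁ ⊔ V₂) le_sup_left
  have e2 : ‖K - K * P‖ ≤ ε / 3 := by
    have h3 : star (K - K * P) = ContinuousLinearMap.adjoint K -
        P * ContinuousLinearMap.adjoint K := by
      rw [star_sub, star_mul, ContinuousLinearMap.star_eq_adjoint,
        (isSelfAdjoint_starProjection _).star_eq]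
    rw [← norm_star, h3]
    exact hV₂ (V₁ ⊔ V₂) le_sup_right
  have h4 : K - P * K * P = (K - P * K) + P * (K - K * P) := by noncomm_ring
  calc ‖K - P * K * P‖ ≤ ‖K - P * K‖ + ‖P * (K - K * P)‖ := by rw [h4]; exact norm_add_le _ _
    _ ≤ ε / 3 + 1 * (ε / 3) := by
        gcongr
        refine (norm_mul_le _ _).trans ?_
        gcongr
        exact Submodule.starProjection_norm_le _
    _ < ε := by linarith

variable (V : Submodule ℂ H) [FiniteDimensional ℂ V]

/-- The extension by `0` on `Vᗮ` of an operator on the finite-dimensional subspace `V`. -/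
def extendByZero (T : V →ₗ[ℂ] V) : H →L[ℂ] H :=
  (V.subtypeL.comp (LinearMap.toContinuousLinearMap T)).comp V.orthogonalProjectionOnto

/-- The compression of a bounded operator to the finite-dimensional subspace `V`. -/
def compression (T : H →L[ℂ] H) : V →ₗ[ℂ] V :=
  ((V.orthogonalProjectionOnto.comp T).comp V.subtypeL : V →L[ℂ] V)

omit [CompleteSpace H] in
theorem extendByZero_apply (T : V →ₗ[ℂ] V) (x : H) :
    extendByZero V T x = T (V.orthogonalProjectionOnto x) := rfl

omit [CompleteSpace H] in
theorem extendByZero_compression (T : H →L[ℂ] H) :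
    extendByZero V (compression V T) = V.starProjection * T * V.starProjection := rfl

omit [CompleteSpace H] in
theorem extendByZero_apply_coe (T : V →ₗ[ℂ] V) (x : V) : extendByZero V T x = T x := by
  rw [extendByZero_apply, V.orthogonalProjectionOnto_mem_subspace_eq_self]

omit [CompleteSpace H] in
theorem extendByZero_mul (S T : V →ₗ[ℂ] V) :
    extendByZero V (S * T) = extendByZero V S * extendByZero V T := by
  ext x
  rw [mul_apply_eq_comp, extendByZero_apply V T, extendByZero_apply_coe, extendByZero_apply]
  rfl

omit [CompleteSpace H] in
theorem extendByZero_sub (S T : V →ₗ[ℂ] V) :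
    extendByZero V (S - T) = extendByZero V S - extendByZero V T := by
  ext x
  simp [extendByZero_apply]

omit [CompleteSpace H] in
theorem extendByZero_zero : extendByZero V 0 = 0 := by
  ext x
  simp [extendByZero_apply]

omit [CompleteSpace H] in
theorem norm_extendByZero_le {T : V →ₗ[ℂ] V} {ε : ℝ} (hε : 0 ≤ ε) (h : ∀ x, ‖T x‖ ≤ ε * ‖x‖) :
    ‖extendByZero V T‖ ≤ ε := by
  refine ContinuousLinearMap.opNorm_le_bound _ hε fun x => ?_
  rw [extendByZero_apply, ← Submodule.coe_norm]
  refine (h _).trans ?_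
  gcongr
  exact V.norm_starProjection_apply_le x

omit [CompleteSpace H] in
theorem isCompactOperator_extendByZero (T : V →ₗ[ℂ] V) :
    IsCompactOperator (extendByZero V T) := by
  have h : IsCompactOperator (V.orthogonalProjectionOnto : H →L[ℂ] V) :=
    isCompactOperator_of_locallyCompactSpace_dom _
  exact h.clm_comp (V.subtypeL.comp (LinearMap.toContinuousLinearMap T))

omit [CompleteSpace H] in
theorem rank_rootSpace_extendByZero (T : V →ₗ[ℂ] V) {μ : ℂ} (hμ : μ ≠ 0) :
    Module.rank ℂ (rootSpace (extendByZero V T) μ) = T.charpoly.rootMultiplicity μ := by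
  have hmaps : ∀ x ∈ V, (extendByZero V T : H →ₗ[ℂ] H) x ∈ V := fun x _ => (T _).2
  have hres : (extendByZero V T : H →ₗ[ℂ] H).restrict hmaps = T := by
    ext x
    exact extendByZero_apply_coe V T x
  -- The operator takes values in `V`, so `T x - μ x ∈ V` with `μ ≠ 0` gives `x ∈ V`; root vectors
  -- follow by induction.
  have hle : rootSpace (extendByZero V T) μ ≤ V := fun x hx => by
    obtain ⟨k, hk⟩ := mem_rootSpace.1 hx
    clear hx
    induction k generalizing x with
    | zero =>
      have : x = 0 := hk
      rw [this]
      exact zero_mem _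
    | succ k ih =>
      have h1 : (extendByZero V T - μ • 1 : H →L[ℂ] H) x ∈ V := ih _ (by
        rw [← mul_apply_eq_comp, ← pow_succ]
        exact hk)
      have h2 : extendByZero V T x - μ • x ∈ V := by simpa using h1
      have h3 : μ • x ∈ V := by
        have := sub_mem (T (V.orthogonalProjectionOnto x)).2 h2
        rwa [← extendByZero_apply, sub_sub_cancel] at this
      exact (V.smul_mem_iff hμ).1 h3
  have h1 : Module.End.maxGenEigenspace T μ =
      Submodule.comap V.subtype (rootSpace (extendByZero V T) μ) := by
    conv_lhs => rw [← hres]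
    exact Module.End.genEigenspace_restrict _ _ _ _ hmaps
  rw [← LinearMap.finrank_maxGenEigenspace_eq, Module.finrank_eq_rank, h1]
  exact (Submodule.comapSubtypeEquivOfLe hle).rank_eq.symm

omit [CompleteSpace H] in
theorem mem_spectrum_extendByZero {T : V →ₗ[ℂ] V} {μ : ℂ} (h : Module.End.HasEigenvalue T μ) :
    μ ∈ spectrum ℂ (extendByZero V T) := by
  obtain ⟨v, hv⟩ := h.exists_hasEigenvector
  refine mem_spectrum_of_mem_rootSpace (x := (v : H)) (mem_rootSpace.2 ⟨1, ?_⟩) ?_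
  · simp [extendByZero_apply_coe, hv.apply_eq_smul]
  · simpa using hv.2

end Sufficiency

/-! ### Approximating a symmetric compact operator by compact commutators -/

section Approximation

variable {H : Type*} [NormedAddCommGroup H] [InnerProductSpace ℂ H] [CompleteSpace H]

/-- The eigenvalues of finite-dimensional compressions close to `K` cluster near the eigenvalues
of `K`, with the right multiplicities. -/
theorem exists_compression_clustered {K : H →L[ℂ] H} (hK : IsCompactOperator K) {ε : ℝ}
    (hε : 0 < ε) :
    ∃ (V : Submodule ℂ H) (_ : FiniteDimensional ℂ V) (r : ℝ),
      ‖K - extendByZero V (compression V K)‖ < ε ∧ r ≤ ε ∧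
      (∀ w ∈ spectrum ℂ K, ε ≤ ‖w‖ → IsIsolatingRadius K w (2 * r)) ∧ 0 < r ∧
      (∀ w ∈ spectrum ℂ K, ε ≤ ‖w‖ →
        Disjoint (sphere w r) (spectrum ℂ (extendByZero V (compression V K))) ∧
        Module.rank ℂ (rangeOf ((Contour.circle w r).riesz (extendByZero V (compression V K)))) =
          Module.rank ℂ (rootSpace K w)) ∧
      ∀ z ∈ spectrum ℂ (extendByZero V (compression V K)), ε ≤ ‖z‖ →
        ∃ w ∈ spectrum ℂ K, ε ≤ ‖w‖ ∧ z ∈ ball w r := by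
  have hfin := hK.finite_spectrum_norm_ge hε
  have hne : ∀ w ∈ {z ∈ spectrum ℂ K | ε ≤ ‖z‖}, w ≠ 0 := fun w hw =>
    norm_pos_iff.1 (hε.trans_le hw.2)
  have hr1 : ∀ᶠ r in 𝓝[>] (0 : ℝ), ∀ w ∈ {z ∈ spectrum ℂ K | ε ≤ ‖z‖}, IsIsolatingRadius K w r :=
    (eventually_all_finite hfin).2 fun w hw => hK.eventually_isIsolatingRadius (hne w hw)
  have hdbl : Tendsto (fun r : ℝ => 2 * r) (𝓝[>] 0) (𝓝[>] 0) := by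
    refine tendsto_nhdsWithin_iff.2 ⟨?_, ?_⟩
    · have : Continuous fun r : ℝ => 2 * r := by fun_prop
      have h0 := this.tendsto 0
      rw [mul_zero] at h0
      exact h0.mono_left nhdsWithin_le_nhds
    · filter_upwards [self_mem_nhdsWithin] with r hr
      exact mul_pos two_pos (mem_Ioi.1 hr)
  have hr2 : ∀ᶠ r in 𝓝[>] (0 : ℝ), r ≤ ε := nhdsWithin_le_nhds (ge_mem_nhds hε)
  -- Isolation at radius `2 * r` makes the discs of radius `r` about different large eigenvalues
  -- disjoint.
  obtain ⟨r, hr1, hr4, hr2, hr3⟩ :=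
    (hr1.and ((hdbl.eventually hr1).and (hr2.and self_mem_nhdsWithin))).exists
  -- The part of a large disc outside all clusters is compact and misses the spectrum of `K`, hence
  -- that of every nearby operator, whose norm is at most `‖K‖ + 1`.
  set S : Set ℂ := closedBall 0 (‖K‖ + 1) \
    (ball 0 ε ∪ ⋃ w ∈ {z ∈ spectrum ℂ K | ε ≤ ‖z‖}, ball w r) with hS
  have hScpt : IsCompact S := (isCompact_closedBall _ _).diff
    (isOpen_ball.union (isOpen_biUnion fun _ _ => isOpen_ball))
  have hSdisj : Disjoint S (spectrum ℂ K) := by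
    refine disjoint_left.2 fun z hz hzK => hz.2 ?_
    by_cases hzε : ‖z‖ < ε
    · exact Or.inl (by simpa using hzε)
    · exact Or.inr (mem_biUnion (show z ∈ {z ∈ spectrum ℂ K | ε ≤ ‖z‖} from ⟨hzK, not_lt.1 hzε⟩)
        (mem_ball_self hr3))
  have hT : ∀ᶠ T in 𝓝 K, Disjoint S (spectrum ℂ T) ∧ ‖T - K‖ < min ε 1 ∧
      ∀ w ∈ {z ∈ spectrum ℂ K | ε ≤ ‖z‖}, Disjoint (sphere w r) (spectrum ℂ T) ∧
        Module.rank ℂ (rangeOf ((Contour.circle w r).riesz T)) =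
          Module.rank ℂ (rootSpace K w) := by
    refine (eventually_disjoint_spectrum hScpt hSdisj).and (Filter.Eventually.and ?_ ?_)
    · have := Metric.ball_mem_nhds K (lt_min hε one_pos)
      filter_upwards [this] with T hT
      rwa [mem_ball, dist_eq_norm] at hT
    · exact (eventually_all_finite hfin).2 fun w hw => (hr1 w hw).eventually_rank_eq hK
  obtain ⟨δ, hδ, hball⟩ := Metric.eventually_nhds_iff_ball.1 hT
  obtain ⟨V, hV, hVδ⟩ := hK.exists_norm_sub_compression_lt hδ
  obtain ⟨h1, h2, h3⟩ := hball (extendByZero V (compression V K)) (by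
    rw [mem_ball, dist_eq_norm, norm_sub_rev, extendByZero_compression]
    exact hVδ)
  refine ⟨V, hV, r, ?_, hr2, fun w hw hwε => hr4 w ⟨hw, hwε⟩, hr3, fun w hw hwε => h3 w ⟨hw, hwε⟩,
    fun z hz hzε => ?_⟩
  · rw [norm_sub_rev]
    exact h2.trans_le (min_le_left _ _)
  · set T := extendByZero V (compression V K) with hTdef
    have hzT : ‖z‖ ≤ ‖K‖ + 1 := by
      have h4 : ‖T‖ ≤ ‖K‖ + 1 := by
        have h5 : ‖T - K‖ < 1 := h2.trans_le (min_le_right _ _)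
        linarith [norm_sub_norm_le T K]
      have : Nontrivial H := by
        by_contra hnt
        rw [not_nontrivial_iff_subsingleton] at hnt
        have : Subsingleton (H →L[ℂ] H) := inferInstance
        rw [spectrum.of_subsingleton] at hz
        exact hz
      exact (spectrum.norm_le_norm_of_mem hz).trans h4
    have h6 : z ∈ ball 0 ε ∪ ⋃ w ∈ {z ∈ spectrum ℂ K | ε ≤ ‖z‖}, ball w r := by
      by_contra h7
      exact disjoint_left.1 h1 (show z ∈ S from ⟨by simpa using hzT, h7⟩) hz
    rcases h6 with h6 | h6
    · exact absurd hzε (not_le.2 (by simpa using h6))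
    · obtain ⟨w, hw, hzw⟩ := mem_iUnion₂.1 h6
      exact ⟨w, hw.1, hw.2, hzw⟩

theorem HasSymmetricRoots.exists_commutator_near {K : H →L[ℂ] H} (hK : IsCompactOperator K)
    (hsym : HasSymmetricRoots K) {ε : ℝ} (hε : 0 < ε) :
    ∃ T ∈ {T : H →L[ℂ] H | IsCompactOperator T} ∩ commutatorsOf (nilTwo H), ‖K - T‖ < 3 * ε := by
  classical
  obtain ⟨V, hV, r, hKV, hrε, hiso, hr, hrank, hspec⟩ := exists_compression_clustered hK hε
  set t := compression V K with ht
  obtain ⟨b, hb⟩ := exists_orthonormalBasis_upperTriangular _ rfl t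
  set d : _ → ℂ := fun i => inner ℂ (b i) (t (b i)) with hd
  have hdspec : ∀ i, d i ∈ spectrum ℂ (extendByZero V t) := fun i => by
    refine mem_spectrum_extendByZero V ?_
    rw [Module.End.hasEigenvalue_iff_isRoot_charpoly, charpoly_eq_prod_of_upperTriangular b t hb,
      Polynomial.IsRoot, Polynomial.eval_prod]
    exact Finset.prod_eq_zero (Finset.mem_univ i) (by simp [hd])
  -- Each diagonal entry is sent to its cluster centre, or to `0` if it lies in no cluster. The last
  -- clause makes membership in a cluster equivalent to having its centre as image.
  have hchoice : ∀ i, ∃ c : ℂ, (c ∈ spectrum ℂ K ∧ ε ≤ ‖c‖ ∧ d i ∈ ball c r) ∨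
      (c = 0 ∧ ‖d i‖ < ε ∧ ¬ ∃ w ∈ spectrum ℂ K, ε ≤ ‖w‖ ∧ d i ∈ ball w r) := by
    intro i
    by_cases h : ∃ w ∈ spectrum ℂ K, ε ≤ ‖w‖ ∧ d i ∈ ball w r
    · obtain ⟨w, hw⟩ := h
      exact ⟨w, Or.inl hw⟩
    · refine ⟨0, Or.inr ⟨rfl, ?_, h⟩⟩
      by_contra hcon
      exact h (hspec _ (hdspec i) (not_lt.1 hcon))
  choose c hc using hchoice
  have hcd : ∀ i, ‖c i - d i‖ ≤ ε := fun i => by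
    rcases hc i with ⟨-, -, h⟩ | ⟨h0, h, -⟩
    · rw [mem_ball, dist_comm, dist_eq_norm] at h
      exact h.le.trans hrε
    · rw [h0, zero_sub, norm_neg]
      exact h.le
  have hcw : ∀ w ∈ spectrum ℂ K, ε ≤ ‖w‖ → ∀ i, c i = w ↔ d i ∈ ball w r := fun w hw hwε i => by
    rcases hc i with ⟨h1, h2, h3⟩ | ⟨h1, -, h3⟩
    · refine ⟨fun h => h ▸ h3, fun h => (hiso w hw hwε).eq_of_mem _ h1 ?_⟩
      rw [mem_ball] at h3 h
      rw [mem_closedBall]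
      linarith [dist_triangle_left (c i) w (d i)]
    · refine ⟨fun h => ?_, fun h => absurd ⟨w, hw, hwε, h⟩ h3⟩
      rw [← h, h1, norm_zero] at hwε
      exact absurd hε (not_lt.2 hwε)
  -- Both sides count the eigenvalues of the compression in the disc about `w`: the right as the
  -- rank of its Riesz idempotent, a sum of root multiplicities, the left as diagonal entries.
  have hcount : ∀ w ∈ spectrum ℂ K, ε ≤ ‖w‖ →
      (Nat.card {i // c i = w} : Cardinal) = Module.rank ℂ (rootSpace K w) := fun w hw hwε => by
    have hrw : r < ‖w‖ := by linarith [(hiso w hw hwε).lt_norm]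
    have hcard : ∀ p : Fin (Module.finrank ℂ V) → Prop,
        (Nat.card {i // p i} : Cardinal) = Cardinal.lift (Cardinal.mk {i // p i}) := fun p => by
      rw [Nat.card_eq_fintype_card, Cardinal.mk_fintype, Cardinal.lift_natCast]
    rw [← (hrank w hw hwε).2, (isCompactOperator_extendByZero V t).rangeOf_riesz_circle hr.le hrw.le
      (hrank w hw hwε).1, rank_iSup_rootSpace]
    have h1 : ∀ μ : ball w r, Module.rank ℂ (rootSpace (extendByZero V t) μ) =
        Cardinal.lift (Cardinal.mk {i // d i = μ}) := fun μ => by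
      have hμ : (μ : ℂ) ≠ 0 := fun h0 => by
        have := μ.2
        rw [h0, mem_ball, dist_zero_left] at this
        exact absurd hrw (not_lt.2 this.le)
      rw [rank_rootSpace_extendByZero V t hμ, rootMultiplicity_charpoly_of_upperTriangular b t hb,
        hcard]
    simp only [h1]
    rw [hcard, ← Cardinal.lift_sum, ← Cardinal.mk_sigma]
    congr 1
    refine Cardinal.mk_congr ((Equiv.subtypeEquivRight (hcw w hw hwε)).trans ?_)
    exact (Equiv.sigmaFiberEquiv fun i : {i // d i ∈ ball w r} => (⟨d i, i.2⟩ : ball w r)).symm.trans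
      (Equiv.sigmaCongrRight fun μ =>
        { toFun := fun i => ⟨i.1.1, congrArg Subtype.val i.2⟩
          invFun := fun i => ⟨⟨i.1, by rw [i.2]; exact μ.2⟩, Subtype.ext i.2⟩
          left_inv := fun _ => rfl
          right_inv := fun _ => rfl })
  have hnegspec : ∀ w ∈ spectrum ℂ K, -w ∈ spectrum ℂ K := fun w hw => by
    rw [(hsym.isWeaklyBalanced hK).spectrum_eq, ← spectrum.neg_eq]
    simpa using hw
  have hsymc : ∀ μ, Nat.card {i // c i = μ} = Nat.card {i // c i = -μ} := by
    intro μ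
    by_cases hμ : μ ∈ spectrum ℂ K ∧ ε ≤ ‖μ‖
    · have h1 := hcount μ hμ.1 hμ.2
      have h2 := hcount (-μ) (hnegspec μ hμ.1) (by rw [norm_neg]; exact hμ.2)
      rw [← hsym μ, ← h1] at h2
      exact_mod_cast h2.symm
    by_cases h0 : μ = 0
    · rw [h0, neg_zero]
    have hempty : ∀ z : ℂ, z ≠ 0 → ¬ (z ∈ spectrum ℂ K ∧ ε ≤ ‖z‖) → IsEmpty {i // c i = z} :=
      fun z hz h => ⟨fun ⟨i, hi⟩ => by
        rcases hc i with ⟨h1, h2, -⟩ | ⟨h1, -⟩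
        · exact h ⟨hi ▸ h1, hi ▸ h2⟩
        · exact hz (hi.symm.trans h1)⟩
    have h1 := hempty μ h0 hμ
    have h2 := hempty (-μ) (neg_ne_zero.2 h0) fun h => hμ
      ⟨by simpa using hnegspec _ h.1, by simpa using h.2⟩
    rw [Nat.card_of_isEmpty, Nat.card_of_isEmpty]
  obtain ⟨e, he, hec, heneg⟩ := exists_injective_perturbation c hsymc hε
  -- One `ε` for moving to the cluster centre and one for separating; compressing `K` costs the
  -- third.
  have hed : ∀ i, ‖e i - d i‖ ≤ 2 * ε := fun i => by
    have := norm_add_le (e i - c i) (c i - d i)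
    rw [sub_add_sub_cancel] at this
    linarith [hec i, hcd i]
  obtain ⟨A, B, hA, hB, hAB⟩ := exists_commutator_near_upperTriangular b t hb e he heneg
    (by positivity) hed
  refine ⟨extendByZero V (A * B - B * A), ⟨isCompactOperator_extendByZero V _,
    extendByZero V A, ?_, extendByZero V B, ?_, ?_⟩, ?_⟩
  · show extendByZero V A ^ 2 = 0
    rw [pow_two, ← extendByZero_mul, hA, extendByZero_zero]
  · show extendByZero V B ^ 2 = 0
    rw [pow_two, ← extendByZero_mul, hB, extendByZero_zero]
  · rw [extendByZero_sub, extendByZero_mul, extendByZero_mul]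
  · have h1 : ‖extendByZero V t - extendByZero V (A * B - B * A)‖ ≤ 2 * ε := by
      rw [norm_sub_rev, ← extendByZero_sub]
      exact norm_extendByZero_le V (by positivity) hAB
    have h2 := norm_add_le (K - extendByZero V t)
      (extendByZero V t - extendByZero V (A * B - B * A))
    rw [sub_add_sub_cancel] at h2
    linarith

theorem HasSymmetricRoots.mem_closure {K : H →L[ℂ] H} (hK : IsCompactOperator K)
    (hsym : HasSymmetricRoots K) :
    K ∈ closure ({T : H →L[ℂ] H | IsCompactOperator T} ∩ commutatorsOf (nilTwo H)) := by
  refine Metric.mem_closure_iff.2 fun ε hε => ?_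
  obtain ⟨T, hT, hKT⟩ := hsym.exists_commutator_near hK (ε := ε / 3) (by positivity)
  refine ⟨T, hT, ?_⟩
  rw [dist_eq_norm]
  linarith

end Approximation

theorem theorem4p15 {H : Type*} [NormedAddCommGroup H] [InnerProductSpace ℂ H] [CompleteSpace H]
    [TopologicalSpace.SeparableSpace H] (K : H →L[ℂ] H) (hK : IsCompactOperator K) :
    List.TFAE [
      K ∈ closure (commutatorsOf (nilTwo H)),
      K ∈ closure (Bal H),
      K ∈ Bal H,
      K ∈ WBal H,
      K ∈ closure ({T : H →L[ℂ] H | IsCompactOperator T} ∩ commutatorsOf (nilTwo H))] := by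
  have hBW : Bal H ⊆ WBal H := fun T hT => hT.toIsWeaklyBalanced
  tfae_have 1 → 3 := fun h =>
    (hasSymmetricRoots_of_mem_closure_commutatorsOf hK h).isBalanced hK
  tfae_have 3 → 2 := fun h => subset_closure h
  tfae_have 2 → 4 := fun h =>
    (hasSymmetricRoots_of_mem_closure_wBal hK (closure_mono hBW h)).isWeaklyBalanced hK
  tfae_have 4 → 5 := fun h =>
    (hasSymmetricRoots_of_mem_closure_wBal hK (subset_closure h)).mem_closure hK
  tfae_have 5 → 1 := fun h => closure_mono inter_subset_right h
  tfae_finish
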